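/- **Setting.** Fix $m,n\in\mathbb N$. An MI-LCQP-graph $G$ encodes a problem $$\min_{x\in\mathbb R^n}\ \tfrac12x^\top Qx+c^\top x\quad\text{s.t. } Ax\circ b,\ \ l\le x\le u,\ \ x_j\in\mathbb Z\ \ \forall j\in I,$$ where $A\in\mathbb R^{m\times n}$, $b\in\mathbb R^m$, $c\in\mathbb R^n$, $l\in(\mathbb R\cup\{-\infty\})^n$, $u\in(\mathbb R\cup\{+\infty\})^n$, $\circ\in\{\le,=,\ge\}^m$, $I\subset\{1,\dots,n\}$, and $Q\in\mathbb R^{n\times n}$ is symmetric positive semidefinite. Its constraint nodes $i\in\{1,\dots,m\}$ carry the features $v_i=(b_i,\circ_i)$ and its variable nodes $j\in\{1,\dots,n\}$ the features $w_j=(c_j,l_j,u_j,\delta_I(j))$, where $\delta_I$ is the indicator of $I$. Put $\mathcal N_i^W=\{j:A_{ij}\ne0\}$, $\mathcal N_j^V=\{i:A_{ij}\neq0\}$, $\mathcal N_j^W=\{j':Q_{jj'}\ne0\}$. The set $\mathcal G^{m,n}$ of these graphs has the subspace topology of the product topology, where $\{-\infty\}$, $\{+\infty\}$, $\{\le,=,\ge\}$,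 $\{0,1\}$ are discrete and $\mathbb R\cup\{\pm\infty\}$ is a disjoint union; the feature spaces are topologized in the same way. **GNNs.** A node-level GNN $F_W$ is given by $L\in\mathbb N$ and continuous maps between feature spaces and finite-dimensional real spaces, independent of $m,n$: $s_i^0=f_0^V(v_i)$, $t_j^0=f_0^W(w_j)$; for $1\le k\le L$, $$s_i^k=f_k^V\Big(s_i^{k-1},\sum_{j\in\mathcal N_i^W}g_k^W(t_j^{k-1},A_{ij})\Big),\qquad t_j^k=f_k^W\Big(t_j^{k-1},\sum_{i\in\mathcal N_j^V}g_k^V(s_i^{k-1},A_{ij}),\sum_{j'\in\mathcal N_j^W}g_k^Q(t_{j'}^{k-1},Q_{jj'})\Big);$$ and the output $F_W(G)\in\mathbb R^n$ has the entries $F_W(G)_j=r\big(\sum_i s_i^L,\sum_{j'}t_{j'}^L,t_j^L\big)$ with $r$ real-valued. **Unfoldability.** The collision-free Weisfeiler–Lehman test starts with the colors $C_i^{0,V}=v_i$, $C_j^{0,W}=w_j$ and refines them by $$C_i^{k,V}=\big(C_i^{k-1,V},\{\{(C_j^{k-1,W},A_{ij}):j\in\mathcal N_i^W\}\}\big),$$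 $$C_j^{k,W}=\big(C_j^{k-1,W},\{\{(C_i^{k-1,V},A_{ij}):i\in\mathcal N_j^V\}\},\{\{(C_{j'}^{k-1,W},Q_{jj'}):j'\in\mathcal N_j^W\}\}\big).$$ $G$ is *unfoldable* if in the final stable partition all variable nodes have different colors, i.e. for all $j\ne j'$ there is $k$ with $C_j^{k,W}\ne C_{j'}^{k,W}$. **Solution map.** The colors of each iteration are linearly ordered: features and tuples lexicographically (with $-\infty$ smallest, $+\infty$ largest, $\le$ before $=$ before $\ge$, $0$ before $1$), and of two distinct multisets the smaller one is that in which the smallest element whose multiplicities differ has the smaller multiplicity. Write $j\prec_Gj'$ if $C_j^{k,W}<C_{j'}^{k,W}$ for some $k$; for unfoldable $G$ this is a strict total order of the variable nodes. Order vectors $x\neq y$ in $\mathbb R^n$ first by the Euclidean norm and, if $\|x\|=\|y\|$, by the values of the entry at the $\prec_G$-first node where $x$ and $y$ differ. If $G$ is unfoldable and has an optimal solution, it has exactly one optimal solution that is minimal in this total order; it is denoted by $\Phi_{\rm sol}(G)$. **Theorem.** Let $\mathbb P$ be a Borel probability measure on $\mathcal G^{m,n}$ such that $\mathbb P$-almost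 every $G$ is unfoldable and has an optimal solution. For all $\epsilon,\delta>0$ there is a node-level GNN $F_W$ such that $$\mathbb P\big[\,\|F_W(G)-\Phi_{\rm sol}(G)\|>\delta\,\big]<\epsilon .$$ -/

import Mathlib

/-!
Mixed-integer linearly constrained quadratic programs (MI-LCQPs), their graphs, message-passing
graph neural networks on them, the Weisfeiler-Lehman (WL) test, and the optimal solution map.
-/

noncomputable section

namespace MILCQP

/-- The type of a linear constraint: `≤`, `=` or `≥`. -/
inductive Rel where
  | le
  | eq
  | ge

namespace Rel

/-- `r.Holds s t` is the relation `s ∘ t`, where `∘` is the symbol `r`. -/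
def Holds : Rel → ℝ → ℝ → Prop
  | le, s, t => s ≤ t
  | eq, s, t => s = t
  | ge, s, t => t ≤ s

/-- The discrete topology. -/
instance : TopologicalSpace Rel := ⊥

instance : DiscreteTopology Rel := ⟨rfl⟩

/-- Numbering of the three symbols. -/
def code : Rel → ℕ
  | le => 0
  | eq => 1
  | ge => 2

theorem code_injective : Function.Injective code := by
  intro r s h
  cases r <;> cases s <;> simp [code] at h ⊢

/-- The order `≤`, `=`, `≥` of the three symbols. -/
instance : LinearOrder Rel := LinearOrder.lift' code code_injective

end Rel

/-- Lower bounds in `{-∞} ∪ ℝ`, with the topology of the disjoint union. -/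
abbrev LowerBound := Unit ⊕ ℝ

/-- Upper bounds in `ℝ ∪ {+∞}`, with the topology of the disjoint union. -/
abbrev UpperBound := ℝ ⊕ Unit

/-- `LowerBoundHolds l t` means `l ≤ t`, where `Sum.inl ()` is `-∞`. -/
def LowerBoundHolds : LowerBound → ℝ → Prop
  | Sum.inl _, _ => True
  | Sum.inr a, t => a ≤ t

/-- `UpperBoundHolds u t` means `t ≤ u`, where `Sum.inr ()` is `+∞`. -/
def UpperBoundHolds : UpperBound → ℝ → Prop
  | Sum.inl a, t => t ≤ a
  | Sum.inr _, _ => True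

/-- The feature `v_i = (b_i, ∘_i)` of a constraint node. -/
abbrev ConFeature := ℝ × Rel

/-- The feature `w_j = (c_j, l_j, u_j, δ_I(j))` of a variable node. -/
abbrev VarFeature := ℝ × LowerBound × UpperBound × Bool

/-- An MI-LCQP-graph with `m` constraint nodes and `n` variable nodes: the data of
`min ½ xᵀ Q x + cᵀ x` subject to `A x ∘ b`, `l ≤ x ≤ u`, `x j ∈ ℤ` for `j ∈ I`,
with `Q` symmetric positive semidefinite. `isInt` is the indicator `δ_I` of `I`. -/
@[ext]
structure Graph (m n : ℕ) where
  A : Matrix (Fin m) (Fin n) ℝ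
  Q : Matrix (Fin n) (Fin n) ℝ
  b : Fin m → ℝ
  rel : Fin m → Rel
  c : Fin n → ℝ
  l : Fin n → LowerBound
  u : Fin n → UpperBound
  isInt : Fin n → Bool
  posSemidef : Q.PosSemidef

namespace Graph

variable {m n : ℕ}

/-- All the data of a graph, as a point of the product space. -/
def data (G : Graph m n) :
    Matrix (Fin m) (Fin n) ℝ × Matrix (Fin n) (Fin n) ℝ × (Fin m → ℝ) × (Fin m → Rel) ×
      (Fin n → ℝ) × (Fin n → LowerBound) × (Fin n → UpperBound) × (Fin n → Bool) :=
  (G.A, G.Q, G.b, G.rel, G.c, G.l, G.u, G.isInt)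

/-- The subspace topology of the product topology. -/
instance : TopologicalSpace (Graph m n) := TopologicalSpace.induced data inferInstance

/-- The Borel sigma-algebra. -/
instance : MeasurableSpace (Graph m n) := borel (Graph m n)

instance : BorelSpace (Graph m n) := ⟨rfl⟩

/-- The feature of the constraint node `i`. -/
def conFeature (G : Graph m n) (i : Fin m) : ConFeature := (G.b i, G.rel i)

/-- The feature of the variable node `j`. -/
def varFeature (G : Graph m n) (j : Fin n) : VarFeature := (G.c j, G.l j, G.u j, G.isInt j)

open scoped Classical in
/-- `N_i^W`: the variable nodes adjacent to the constraint node `i`. -/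
def nbrVW (G : Graph m n) (i : Fin m) : Finset (Fin n) := {j | G.A i j ≠ 0}

open scoped Classical in
/-- `N_j^V`: the constraint nodes adjacent to the variable node `j`. -/
def nbrWV (G : Graph m n) (j : Fin n) : Finset (Fin m) := {i | G.A i j ≠ 0}

open scoped Classical in
/-- `N_j^W`: the variable nodes adjacent to the variable node `j`. -/
def nbrWW (G : Graph m n) (j : Fin n) : Finset (Fin n) := {j' | G.Q j j' ≠ 0}

/-! ### The optimization problem -/

/-- `x` satisfies all constraints. -/
def Feasible (G : Graph m n) (x : EuclideanSpace ℝ (Fin n)) : Prop :=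
  (∀ i, (G.rel i).Holds (∑ j, G.A i j * x j) (G.b i)) ∧
  (∀ j, LowerBoundHolds (G.l j) (x j)) ∧
  (∀ j, UpperBoundHolds (G.u j) (x j)) ∧
  ∀ j, G.isInt j = true → ∃ z : ℤ, x j = z

/-- The objective `½ xᵀ Q x + cᵀ x`. -/
def objective (G : Graph m n) (x : EuclideanSpace ℝ (Fin n)) : ℝ :=
  (1 / 2 : ℝ) * ∑ j, ∑ j', x j * G.Q j j' * x j' + ∑ j, G.c j * x j

/-- `x` is an optimal solution. -/
def IsOptimal (G : Graph m n) (x : EuclideanSpace ℝ (Fin n)) : Prop :=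
  G.Feasible x ∧ ∀ y, G.Feasible y → G.objective x ≤ G.objective y

end Graph

/-- The graphs whose problem has an optimal solution. -/
def solvable (m n : ℕ) : Set (Graph m n) := {G | ∃ x, G.IsOptimal x}

/-! ### Message-passing graph neural networks with node-level output -/

/-- A GNN with node-level output. It does not depend on `m` and `n`. Layer `k + 1` is given by
`fV k`, `fW k`, `gV k`, `gW k`, `gQ k`; only the layers `1, …, L` are used. -/
structure GNN where
  /-- the number of message-passing layers -/
  L : ℕ
  /-- dimensions of the features of the constraint nodes and of the variable nodes -/
  dV : ℕ → ℕ
  dW : ℕ → ℕ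
  /-- dimensions of the messages -/
  eV : ℕ → ℕ
  eW : ℕ → ℕ
  eQ : ℕ → ℕ
  f0V : ConFeature → (Fin (dV 0) → ℝ)
  f0W : VarFeature → (Fin (dW 0) → ℝ)
  fV : ∀ k, (Fin (dV k) → ℝ) × (Fin (eW k) → ℝ) → (Fin (dV (k + 1)) → ℝ)
  fW : ∀ k, (Fin (dW k) → ℝ) × (Fin (eV k) → ℝ) × (Fin (eQ k) → ℝ) → (Fin (dW (k + 1)) → ℝ)
  gV : ∀ k, (Fin (dV k) → ℝ) × ℝ → (Fin (eV k) → ℝ)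
  gW : ∀ k, (Fin (dW k) → ℝ) × ℝ → (Fin (eW k) → ℝ)
  gQ : ∀ k, (Fin (dW k) → ℝ) × ℝ → (Fin (eQ k) → ℝ)
  r : (Fin (dV L) → ℝ) × (Fin (dW L) → ℝ) × (Fin (dW L) → ℝ) → ℝ
  continuous_f0V : Continuous f0V
  continuous_f0W : Continuous f0W
  continuous_fV : ∀ k, Continuous (fV k)
  continuous_fW : ∀ k, Continuous (fW k)
  continuous_gV : ∀ k, Continuous (gV k)
  continuous_gW : ∀ k, Continuous (gW k)
  continuous_gQ : ∀ k, Continuous (gQ k)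
  continuous_r : Continuous r

namespace GNN

variable {m n : ℕ}

/-- The features `s_i^k` of the constraint nodes and `t_j^k` of the variable nodes. -/
def features (F : GNN) (G : Graph m n) :
    (k : ℕ) → (Fin m → Fin (F.dV k) → ℝ) × (Fin n → Fin (F.dW k) → ℝ)
  | 0 => (fun i => F.f0V (G.conFeature i), fun j => F.f0W (G.varFeature j))
  | k + 1 =>
    let s := (features F G k).1
    let t := (features F G k).2
    (fun i => F.fV k (s i, ∑ j ∈ G.nbrVW i, F.gW k (t j, G.A i j)),
     fun j => F.fW k (t j, ∑ i ∈ G.nbrWV j, F.gV k (s i, G.A i j),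
       ∑ j' ∈ G.nbrWW j, F.gQ k (t j', G.Q j j')))

/-- The node-level output `y_j = r (∑ i, s_i^L, ∑ j', t_{j'}^L, t_j^L)`. -/
def output (F : GNN) (G : Graph m n) : EuclideanSpace ℝ (Fin n) :=
  WithLp.toLp 2 fun j =>
    F.r (∑ i, (F.features G F.L).1 i, ∑ j', (F.features G F.L).2 j', (F.features G F.L).2 j)

end GNN

/-! ### The WL test

The test is run without collisions: the hash of a tuple is the tuple itself, so that the colors of
the iteration `k + 1` are built from those of the iteration `k`. A multiset is recorded by its
multiplicity function. The colors of each iteration are linearly ordered: features and tuples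
lexicographically, and two distinct multisets by the multiplicity of the smallest
element whose multiplicities differ. -/

/-- A pair of linearly ordered types of colors, for the constraint nodes and the variable nodes. -/
structure ColorSpace : Type 1 where
  V : Type
  W : Type
  ordV : LinearOrder V
  ordW : LinearOrder W

attribute [instance] ColorSpace.ordV ColorSpace.ordW

/-- Multisets in `α`, as multiplicity functions, lexicographically ordered. -/
abbrev MultisetLex (α : Type) := Lex (α →₀ ℕ)

/-- The multiset `{{ f a : a ∈ s }}`. -/
def mset {ι α : Type} (s : Finset ι) (f : ι → α) : MultisetLex α :=
  toLex (∑ a ∈ s, Finsupp.single (f a) 1)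

/-- The colors available at each iteration. -/
def colorSpace : ℕ → ColorSpace
  | 0 =>
    { V := ℝ ×ₗ Rel
      W := ℝ ×ₗ (Unit ⊕ₗ ℝ) ×ₗ (ℝ ⊕ₗ Unit) ×ₗ Bool
      ordV := inferInstance
      ordW := inferInstance }
  | k + 1 =>
    { V := (colorSpace k).V ×ₗ MultisetLex ((colorSpace k).W ×ₗ ℝ)
      W := (colorSpace k).W ×ₗ MultisetLex ((colorSpace k).V ×ₗ ℝ) ×ₗ
        MultisetLex ((colorSpace k).W ×ₗ ℝ)
      ordV := inferInstance
      ordW := inferInstance }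

namespace Graph

variable {m n : ℕ}

/-- The colors `C_i^{k,V}` and `C_j^{k,W}` after `k` iterations of the WL test. -/
def wlColors (G : Graph m n) :
    (k : ℕ) → (Fin m → (colorSpace k).V) × (Fin n → (colorSpace k).W)
  | 0 =>
    (fun i => (toLex (G.b i, G.rel i) : ℝ ×ₗ Rel),
     fun j => (toLex (G.c j, toLex (toLex (G.l j), toLex (toLex (G.u j), G.isInt j))) :
      ℝ ×ₗ (Unit ⊕ₗ ℝ) ×ₗ (ℝ ⊕ₗ Unit) ×ₗ Bool))
  | k + 1 =>
    let CV := (wlColors G k).1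
    let CW := (wlColors G k).2
    (fun i => (toLex (CV i, mset (G.nbrVW i) fun j => toLex (CW j, G.A i j)) :
      (colorSpace k).V ×ₗ MultisetLex ((colorSpace k).W ×ₗ ℝ)),
     fun j => (toLex (CW j, toLex (mset (G.nbrWV j) fun i => toLex (CV i, G.A i j),
        mset (G.nbrWW j) fun j' => toLex (CW j', G.Q j j'))) :
      (colorSpace k).W ×ₗ MultisetLex ((colorSpace k).V ×ₗ ℝ) ×ₗ
        MultisetLex ((colorSpace k).W ×ₗ ℝ)))

/-- The color `C_j^{k,W}` of the variable node `j`. -/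
def colorW (G : Graph m n) (k : ℕ) (j : Fin n) : (colorSpace k).W := (G.wlColors k).2 j

/-- The final stable partition of the variable nodes: two nodes are in one class when
no iteration separates them. -/
def stablePartitionW (G : Graph m n) : Setoid (Fin n) where
  r j j' := ∀ k, G.colorW k j = G.colorW k j'
  iseqv := ⟨fun _ _ => rfl, fun h k => (h k).symm, fun h h' k => (h k).trans (h' k)⟩

/-- All classes of the final stable partition of the variable nodes are singletons. -/
def Unfoldable (G : Graph m n) : Prop := ∀ j j', G.stablePartitionW j j' → j = j'

theorem colorW_succ_lt (G : Graph m n) (k : ℕ) (j j' : Fin n)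
    (h : G.colorW k j < G.colorW k j') : G.colorW (k + 1) j < G.colorW (k + 1) j' :=
  Prod.Lex.toLex_lt_toLex.2 (Or.inl h)

theorem colorW_lt_mono (G : Graph m n) {k k' : ℕ} (hk : k ≤ k') (j j' : Fin n)
    (h : G.colorW k j < G.colorW k j') : G.colorW k' j < G.colorW k' j' := by
  induction hk with
  | refl => exact h
  | step _ ih => exact G.colorW_succ_lt _ j j' ih

/-- The partition given by the colors is the final stable one from some iteration on. -/
theorem exists_stable (G : Graph m n) : ∃ K, ∀ k, K ≤ k → ∀ j j',
    G.colorW k j = G.colorW k j' ↔ G.stablePartitionW j j' := by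
  have h : ∀ p : Fin n × Fin n, ∃ K, ∀ k, K ≤ k →
      (G.colorW k p.1 = G.colorW k p.2 → G.stablePartitionW p.1 p.2) := by
    intro p
    by_cases hp : G.stablePartitionW p.1 p.2
    · exact ⟨0, fun _ _ _ => hp⟩
    · obtain ⟨K, hK⟩ := not_forall.1 hp
      refine ⟨K, fun k hk he => absurd he ?_⟩
      rcases lt_or_gt_of_ne hK with h | h
      · exact (G.colorW_lt_mono hk _ _ h).ne
      · exact (G.colorW_lt_mono hk _ _ h).ne'
  choose K hK using h
  refine ⟨Finset.univ.sup K, fun k hk j j' => ⟨fun he => ?_, fun hs => hs k⟩⟩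
  exact hK (j, j') k ((Finset.le_sup (Finset.mem_univ _)).trans hk) he

/-! ### The optimal solution map -/

/-- The order of the variable nodes by their colors: an iteration that separates two nodes
orders them, and later iterations keep that order. -/
def VarLT (G : Graph m n) (j j' : Fin n) : Prop := ∃ k, G.colorW k j < G.colorW k j'

/-- The order of the vectors: first by the Euclidean norm, then lexicographically, the entries being
read in the order of the variable nodes. -/
def SolLT (G : Graph m n) (x y : EuclideanSpace ℝ (Fin n)) : Prop :=
  ‖x‖ < ‖y‖ ∨ ‖x‖ = ‖y‖ ∧ ∃ j, (∀ j', G.VarLT j' j → x j' = y j') ∧ x j < y j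

/-- `x` is the smallest optimal solution. -/
def IsLeastOptimal (G : Graph m n) (x : EuclideanSpace ℝ (Fin n)) : Prop :=
  G.IsOptimal x ∧ ∀ y, G.IsOptimal y → y ≠ x → G.SolLT x y

open scoped Classical in
/-- The optimal solution map: the smallest optimal solution, which exists and is unique for an
unfoldable graph with an optimal solution (see `existsUnique_isLeastOptimal`). -/
def solMap (G : Graph m n) : EuclideanSpace ℝ (Fin n) :=
  if h : ∃ x, G.IsLeastOptimal x then h.choose else 0

end Graph

/-- The unfoldable graphs. -/
def unfoldable (m n : ℕ) : Set (Graph m n) := {G | G.Unfoldable}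

namespace Graph

variable {m n : ℕ}

/-- On an unfoldable graph the order of the variable nodes is a strict total order. -/
theorem varLT_isStrictTotalOrder (G : Graph m n) (hG : G.Unfoldable) :
    IsStrictTotalOrder (Fin n) G.VarLT where
  irrefl := fun _ ⟨_, hk⟩ => lt_irrefl _ hk
  trans := fun _ _ _ ⟨k, hk⟩ ⟨k', hk'⟩ => ⟨max k k',
    (G.colorW_lt_mono (le_max_left k k') _ _ hk).trans
      (G.colorW_lt_mono (le_max_right k k') _ _ hk')⟩
  trichotomous := fun j j' h h' => hG j j' fun k => by
    by_contra hne
    rcases lt_or_gt_of_ne hne with h1 | h1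
    · exact h ⟨k, h1⟩
    · exact h' ⟨k, h1⟩

/-- On an unfoldable graph the order of the vectors is a strict total order. -/
theorem solLT_isStrictTotalOrder (G : Graph m n) (hG : G.Unfoldable) :
    IsStrictTotalOrder (EuclideanSpace ℝ (Fin n)) G.SolLT := by
  have hV := G.varLT_isStrictTotalOrder hG
  refine { irrefl := ?irr, trans := ?tr, trichotomous := ?tri }
  case irr =>
    rintro x (h | ⟨-, j, -, h⟩) <;> exact lt_irrefl _ h
  case tr =>
    rintro x y z (h | ⟨h, j, hj, hxy⟩) (h' | ⟨h', j', hj', hyz⟩)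
    · exact Or.inl (h.trans h')
    · exact Or.inl (h' ▸ h)
    · exact Or.inl (h ▸ h')
    · refine Or.inr ⟨h.trans h', ?_⟩
      rcases trichotomous_of G.VarLT j j' with hlt | rfl | hlt
      · exact ⟨j, fun i hi => (hj i hi).trans (hj' i (hV.trans _ _ _ hi hlt)),
          hj' j hlt ▸ hxy⟩
      · exact ⟨j, fun i hi => (hj i hi).trans (hj' i hi), hxy.trans hyz⟩
      · exact ⟨j', fun i hi => (hj i (hV.trans _ _ _ hi hlt)).trans (hj' i hi),
          (hj j' hlt).symm ▸ hyz⟩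
  case tri =>
    intro x y hxy hyx
    by_contra hne
    have hnorm : ‖x‖ = ‖y‖ := le_antisymm (not_lt.1 fun h => hyx (Or.inl h))
      (not_lt.1 fun h => hxy (Or.inl h))
    have hex : ∃ j, x j ≠ y j := by
      by_contra hall
      push Not at hall
      exact hne (PiLp.ext hall)
    obtain ⟨j, hj, hmin⟩ := (Finite.wellFounded_of_trans_of_irrefl G.VarLT).has_min
      {j | x j ≠ y j} hex
    have hlow : ∀ j', G.VarLT j' j → x j' = y j' := fun j' h => by
      by_contra h'
      exact hmin j' h' h
    rcases lt_or_gt_of_ne hj with h | h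
    · exact hxy (Or.inr ⟨hnorm, j, hlow, h⟩)
    · exact hyx (Or.inr ⟨hnorm.symm, j, fun j' h' => (hlow j' h').symm, h⟩)

theorem continuous_objective (G : Graph m n) : Continuous G.objective := by
  unfold objective
  fun_prop

theorem isClosed_feasible (G : Graph m n) : IsClosed {x | G.Feasible x} := by
  have h1 : IsClosed {x : EuclideanSpace ℝ (Fin n) |
      ∀ i, (G.rel i).Holds (∑ j, G.A i j * x j) (G.b i)} := by
    simp only [Set.ofPred_forall]
    refine isClosed_iInter fun i => ?_
    have hc : Continuous fun x : EuclideanSpace ℝ (Fin n) => ∑ j, G.A i j * x j := by fun_prop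
    cases G.rel i
    · exact isClosed_le hc continuous_const
    · exact isClosed_eq hc continuous_const
    · exact isClosed_le continuous_const hc
  have hx : ∀ j, Continuous fun x : EuclideanSpace ℝ (Fin n) => x j := fun j => by fun_prop
  have h2 : IsClosed {x : EuclideanSpace ℝ (Fin n) | ∀ j, LowerBoundHolds (G.l j) (x j)} := by
    simp only [Set.ofPred_forall]
    refine isClosed_iInter fun j => ?_
    cases G.l j
    · simp [LowerBoundHolds]
    · exact isClosed_le continuous_const (hx j)
  have h3 : IsClosed {x : EuclideanSpace ℝ (Fin n) | ∀ j, UpperBoundHolds (G.u j) (x j)} := by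
    simp only [Set.ofPred_forall]
    refine isClosed_iInter fun j => ?_
    cases G.u j
    · exact isClosed_le (hx j) continuous_const
    · simp [UpperBoundHolds]
  have h4 : IsClosed {x : EuclideanSpace ℝ (Fin n) |
      ∀ j, G.isInt j = true → ∃ z : ℤ, x j = z} := by
    simp only [Set.ofPred_forall]
    refine isClosed_iInter fun j => isClosed_iInter fun _ => ?_
    have hz : IsClosed (Set.range ((↑) : ℤ → ℝ)) := Int.isClosedEmbedding_coe_real.isClosed_range
    have he : {x : EuclideanSpace ℝ (Fin n) | ∃ z : ℤ, x j = z} =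
        (fun x : EuclideanSpace ℝ (Fin n) => x j) ⁻¹' Set.range ((↑) : ℤ → ℝ) := by
      ext x
      simp [eq_comm]
    rw [he]
    exact hz.preimage (hx j)
  exact h1.inter (h2.inter (h3.inter h4))

theorem isClosed_optimal (G : Graph m n) : IsClosed {x | G.IsOptimal x} := by
  have h : IsClosed {x | ∀ y, G.Feasible y → G.objective x ≤ G.objective y} := by
    simp only [Set.ofPred_forall]
    exact isClosed_iInter fun y => isClosed_iInter fun _ =>
      isClosed_le G.continuous_objective continuous_const
  exact G.isClosed_feasible.inter h

/-- A nonempty compact set has a lexicographically smallest element. -/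
theorem exists_lex_min {α : Type} [LinearOrder α] (f : Fin n → α)
    {K : Set (EuclideanSpace ℝ (Fin n))} (hK : IsCompact K) (hne : K.Nonempty)
    (S : Finset (Fin n)) :
    ∃ K' ⊆ K, IsCompact K' ∧ K'.Nonempty ∧ ∀ x ∈ K', ∀ y ∈ K,
      (y ∈ K' ∧ ∀ j ∈ S, x j = y j) ∨
      ∃ j ∈ S, (∀ j' ∈ S, f j' < f j → x j' = y j') ∧ x j < y j := by
  induction S using Finset.induction_on_max_value f with
  | empty => exact ⟨K, subset_rfl, hK, hne, fun x _ y hy => Or.inl ⟨hy, by simp⟩⟩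
  | insert a S ha hmax ih =>
    obtain ⟨K', hsub, hK', hne', hlex⟩ := ih
    have hc : Continuous fun x : EuclideanSpace ℝ (Fin n) => x a := by fun_prop
    obtain ⟨z, hz, hzmin⟩ := hK'.exists_isMinOn hne' hc.continuousOn
    refine ⟨K' ∩ {x | x a ≤ z a}, Set.inter_subset_left.trans hsub,
      hK'.inter_right (isClosed_le hc continuous_const), ⟨z, hz, le_refl (z a)⟩, ?_⟩
    rintro x ⟨hx, hxz⟩ y hy
    rcases hlex x hx y hy with ⟨hy', heq⟩ | ⟨j, hj, hlow, hlt⟩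
    · have hza : z a ≤ y a := hzmin hy'
      rcases (le_trans hxz hza : x a ≤ y a).eq_or_lt with h | h
      · refine Or.inl ⟨⟨hy', ?_⟩, ?_⟩
        · exact (h.symm.trans_le hxz : y a ≤ z a)
        · intro j hj
          rcases Finset.mem_insert.1 hj with rfl | hj
          · exact h
          · exact heq j hj
      · refine Or.inr ⟨a, Finset.mem_insert_self a S, fun j' hj' hlt => ?_, h⟩
        rcases Finset.mem_insert.1 hj' with rfl | hj'
        · exact absurd hlt (lt_irrefl _)
        · exact heq j' hj'
    · refine Or.inr ⟨j, Finset.mem_insert_of_mem hj, fun j' hj' hlt' => ?_, hlt⟩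
      rcases Finset.mem_insert.1 hj' with rfl | hj'
      · exact absurd hlt' (not_lt.2 (hmax j hj))
      · exact hlow j' hj' hlt'

/-- An unfoldable graph with an optimal solution has exactly one smallest optimal solution. -/
theorem existsUnique_isLeastOptimal (G : Graph m n) (hG : G.Unfoldable)
    (hS : ∃ x, G.IsOptimal x) : ∃! x, G.IsLeastOptimal x := by
  have hS' := G.solLT_isStrictTotalOrder hG
  obtain ⟨x₀, hx₀⟩ := hS
  obtain ⟨N, hN⟩ := G.exists_stable
  have hinj : ∀ j j', G.VarLT j' j → G.colorW N j' < G.colorW N j := by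
    rintro j j' ⟨k, hk⟩
    by_contra hlt
    rcases (not_lt.1 hlt).eq_or_lt with h | h
    · exact hk.ne' (((hN N le_rfl j j').1 h) k)
    · exact lt_asymm (G.colorW_lt_mono (le_max_left k N) _ _ hk)
        (G.colorW_lt_mono (le_max_right k N) _ _ h)
  have hcpt : IsCompact ({x | G.IsOptimal x} ∩ Metric.closedBall 0 ‖x₀‖) :=
    (isCompact_closedBall _ _).inter_left G.isClosed_optimal
  obtain ⟨z, hz, hzmin⟩ := hcpt.exists_isMinOn ⟨x₀, hx₀, by simp⟩ continuous_norm.continuousOn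
  have hzmin' : ∀ y, G.IsOptimal y → ‖z‖ ≤ ‖y‖ := by
    intro y hy
    by_cases hyx : ‖y‖ ≤ ‖x₀‖
    · exact hzmin (a := y) ⟨hy, by simpa using hyx⟩
    · have : ‖z‖ ≤ ‖x₀‖ := by simpa using hz.2
      exact this.trans (not_le.1 hyx).le
  obtain ⟨K', hsub, -, ⟨x, hx⟩, hlex⟩ := exists_lex_min (G.colorW N)
    (K := ({x | G.IsOptimal x} ∩ Metric.closedBall 0 ‖z‖))
    ((isCompact_closedBall _ _).inter_left G.isClosed_optimal)
    ⟨z, hz.1, by simp⟩ Finset.univ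
  have hxo : G.IsOptimal x := (hsub hx).1
  have hxn : ‖x‖ = ‖z‖ := le_antisymm (by simpa using (hsub hx).2) (hzmin' x hxo)
  have hleast : G.IsLeastOptimal x := by
    refine ⟨hxo, fun y hy hyx => ?_⟩
    rcases (hzmin' y hy).eq_or_lt with h | h
    · rcases hlex x hx y ⟨hy, by simp [h]⟩ with ⟨-, heq⟩ | ⟨j, -, hlow, hlt⟩
      · exact absurd (PiLp.ext fun j => (heq j (Finset.mem_univ j)).symm) hyx
      · exact Or.inr ⟨hxn.trans h, j,
          fun j' hj' => hlow j' (Finset.mem_univ _) (hinj _ _ hj'), hlt⟩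
    · exact Or.inl (hxn ▸ h)
  refine ⟨x, hleast, fun y hy => ?_⟩
  by_contra hne
  exact hS'.irrefl x (hS'.trans _ _ _ (hleast.2 y hy.1 hne) (hy.2 x hxo (Ne.symm hne)))

theorem solMap_isLeastOptimal (G : Graph m n) (hG : G.Unfoldable)
    (hS : ∃ x, G.IsOptimal x) : G.IsLeastOptimal G.solMap := by
  have h := (G.existsUnique_isLeastOptimal hG hS).exists
  rw [solMap, dif_pos h]
  exact h.choose_spec

end Graph

end MILCQP

end

noncomputable section

namespace MILCQP

/-! ### Moments of finite families of points -/

/-! The proof shows that a network can be at least as fine as the WL test. For unfoldable graphs the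
WL colors fix the problem up to relabelling of its nodes, so the entries of the solution are a
function of what the network sees. Lusin's theorem then supplies a compact set, of nearly full
measure, on which the solution map is continuous, and on this set the network reproduces the map
exactly.

Separation. Finitely many monomials interpolate at any bounded number of points, so a sum of moment
vectors over a small family determines the multiset of its points (`map_eq_of_sum_moment_eq`). With
such sums as aggregation, the features of `momentGNN` determine the WL colors, even across different
graphs (`wlColors_eq_of_momentFeatures_eq`). If the colors after `K` rounds distinguish all variable
nodes, one further round reveals every entry of `A` and `Q`. Two such graphs with equal readout
arguments at `j` and `j'` are therefore isomorphic by a map taking `j` to `j'`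
(`Graph.isIso_of_wlColors_eq`). The order that selects the solution is built from colors and the
norm, so isomorphisms preserve it, and the two entries agree (`solMap_eq_of_readoutArg_eq`).

Continuity. Messages carry the edge weight as a factor. Sums over neighbours are then sums over all
nodes, continuous in the graph although neighbourhoods jump. On a compact set where the solution map
is continuous, the quotient property and Tietze's theorem give a continuous readout
(`exists_output_eq_solMap`).

Measurability. The set of minimizers is tracked through the compact sets it hits
(`measurableSet_argminOn_hits`), and colors are handled only through comparisons
(`measurableComparison_wlColors`). On each piece with a fixed order of the nodes, the solution comes
from successive minimizations (`measurableSet_solMap_preimage`). Since almost every graph is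
separated at some finite round, one `K` serves all but a set of small measure. -/

/-- All monomials in `D` variables whose exponents are smaller than `N`. -/
def moment (N : ℕ) {D : ℕ} (x : Fin D → ℝ) : Fin (N ^ D) → ℝ :=
  fun a => ∏ i, x i ^ (finFunctionFinEquiv.symm a i : ℕ)

theorem continuous_moment (N D : ℕ) : Continuous (moment N : (Fin D → ℝ) → _) := by
  unfold moment
  fun_prop

/-- The monomials interpolate arbitrary values at `N` points. -/
theorem exists_moment_functional {N D : ℕ} (s : Finset (Fin D → ℝ)) (hs : s.card ≤ N)
    (p₀ : Fin D → ℝ) (hp₀ : p₀ ∈ s) :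
    ∃ c : Fin (N ^ D) → ℝ, ∀ p ∈ s, ∑ a, c a * moment N p a = if p = p₀ then 1 else 0 := by
  classical
  let S : Fin D → Finset ℝ := fun i => s.image fun p => p i
  have hS : ∀ i, ∀ p ∈ s, p i ∈ S i := fun i p hp => Finset.mem_image_of_mem _ hp
  -- The product over the coordinates of these Lagrange polynomials is 1 at `p₀` and vanishes at
  -- every other point of `s`, since such a point differs from `p₀` in some coordinate.
  let B : Fin D → Polynomial ℝ := fun i => Lagrange.basis (S i) id (p₀ i)
  have hdeg : ∀ i, (B i).natDegree < N := by
    intro i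
    have h1 : (B i).natDegree = (S i).card - 1 :=
      Lagrange.natDegree_basis Function.injective_id.injOn (hS i p₀ hp₀)
    have h2 : (S i).card ≤ s.card := Finset.card_image_le
    have h3 : 0 < (S i).card := Finset.card_pos.2 ⟨_, hS i p₀ hp₀⟩
    omega
  have hexp : ∀ i t, (B i).eval t = ∑ k : Fin N, (B i).coeff k * t ^ (k : ℕ) := by
    intro i t
    rw [Polynomial.eval_eq_sum_range' (hdeg i), Finset.sum_range]
  refine ⟨fun a => ∏ i, (B i).coeff (finFunctionFinEquiv.symm a i), fun p hp => ?_⟩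
  have h1 : ∑ a, (∏ i, (B i).coeff (finFunctionFinEquiv.symm a i)) * moment N p a =
      ∏ i, (B i).eval (p i) := by
    simp_rw [hexp, Fintype.prod_sum, moment, ← Finset.prod_mul_distrib]
    exact Equiv.sum_comp finFunctionFinEquiv.symm
      (fun α : Fin D → Fin N => ∏ i, (B i).coeff (α i) * p i ^ (α i : ℕ))
  rw [h1]
  split_ifs with h
  · subst h
    exact Finset.prod_eq_one fun i _ =>
      Lagrange.eval_basis_self Function.injective_id.injOn (hS i p hp)
  · obtain ⟨i, hi⟩ := Function.ne_iff.1 h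
    exact Finset.prod_eq_zero (Finset.mem_univ i)
      (Lagrange.eval_basis_of_ne (v := id) (Ne.symm hi) (hS i p hp))

/-- Moments of a weighted family of fewer than `N` points determine the weights. -/
theorem sum_filter_eq_of_sum_moment_eq {ι κ : Type} {N D : ℕ} (s : Finset ι) (t : Finset κ)
    (p : ι → Fin D → ℝ) (q : κ → Fin D → ℝ) (w : ι → ℝ) (v : κ → ℝ)
    (hN : s.card + t.card < N)
    (h : ∑ i ∈ s, w i • moment N (p i) = ∑ i ∈ t, v i • moment N (q i)) (x : Fin D → ℝ) :
    ∑ i ∈ s with p i = x, w i = ∑ i ∈ t with q i = x, v i := by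
  classical
  -- The point `x` need not be a value of `p` or `q`; inserting it costs one interpolation node,
  -- which the strict inequality in `hN` provides.
  have hcard : (insert x (s.image p ∪ t.image q)).card ≤ N := by
    have h1 := Finset.card_insert_le x (s.image p ∪ t.image q)
    have h2 := Finset.card_union_le (s.image p) (t.image q)
    have h3 : (s.image p).card ≤ s.card := Finset.card_image_le
    have h4 : (t.image q).card ≤ t.card := Finset.card_image_le
    omega
  obtain ⟨c, hc⟩ := exists_moment_functional _ hcard x (Finset.mem_insert_self _ _)
  have key : ∀ {γ : Type _} (r : Finset γ) (f : γ → Fin D → ℝ) (u : γ → ℝ),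
      (∀ i ∈ r, f i ∈ insert x (s.image p ∪ t.image q)) →
      ∑ a, c a * (∑ i ∈ r, u i • moment N (f i)) a = ∑ i ∈ r with f i = x, u i := by
    intro γ r f u hf
    simp_rw [Finset.sum_apply, Finset.mul_sum]
    rw [Finset.sum_comm, Finset.sum_filter]
    refine Finset.sum_congr rfl fun i hi => ?_
    have h1 := hc _ (hf i hi)
    calc ∑ a, c a * (u i • moment N (f i)) a = u i * ∑ a, c a * moment N (f i) a := by
          rw [Finset.mul_sum]
          exact Finset.sum_congr rfl fun a _ => by simp only [Pi.smul_apply, smul_eq_mul]; ring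
      _ = if f i = x then u i else 0 := by rw [h1]; simp
  rw [← key s p w fun i hi => by simp only [Finset.mem_insert, Finset.mem_union]
                                 exact Or.inr (Or.inl (Finset.mem_image_of_mem _ hi)),
    ← key t q v fun i hi => by simp only [Finset.mem_insert, Finset.mem_union]
                               exact Or.inr (Or.inr (Finset.mem_image_of_mem _ hi)), h]

/-- Moments with nowhere vanishing weights that depend on the point determine the multiset of
the points. -/
theorem map_eq_of_sum_moment_eq {ι κ : Type} {N D : ℕ} (s : Finset ι) (t : Finset κ)
    (p : ι → Fin D → ℝ) (q : κ → Fin D → ℝ) (a : (Fin D → ℝ) → ℝ)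
    (hp : ∀ i ∈ s, a (p i) ≠ 0) (hq : ∀ i ∈ t, a (q i) ≠ 0) (hN : s.card + t.card < N)
    (h : ∑ i ∈ s, a (p i) • moment N (p i) = ∑ i ∈ t, a (q i) • moment N (q i)) :
    s.val.map p = t.val.map q := by
  classical
  ext x
  have key : ∀ {γ : Type _} (r : Finset γ) (f : γ → Fin D → ℝ),
      (r.val.map f).count x = (r.filter fun i => f i = x).card ∧
      ∑ i ∈ r with f i = x, a (f i) = (r.filter fun i => f i = x).card * a x := by
    intro γ r f
    constructor
    · rw [Multiset.count_map, Finset.card_def, Finset.filter_val]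
      simp only [eq_comm]
    · rw [Finset.sum_congr rfl (g := fun _ => a x)
        (fun i hi => by rw [(Finset.mem_filter.1 hi).2]), Finset.sum_const, nsmul_eq_mul]
  have h1 := sum_filter_eq_of_sum_moment_eq s t p q _ _ hN h x
  rw [(key s p).2, (key t q).2] at h1
  rw [(key s p).1, (key t q).1]
  -- The weights over `x` add up to the multiplicity of `x` times `a x`. If that factor is zero,
  -- nonvanishing of the weights empties both fibers; otherwise it cancels.
  by_cases hx : a x = 0
  · have h2 : (s.filter fun i => p i = x) = ∅ :=
      Finset.filter_eq_empty_iff.2 fun i hi he => hp i hi (he ▸ hx)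
    have h3 : (t.filter fun i => q i = x) = ∅ :=
      Finset.filter_eq_empty_iff.2 fun i hi he => hq i hi (he ▸ hx)
    rw [h2, h3]
    rfl
  · exact_mod_cast mul_right_cancel₀ hx h1

theorem moment_injective {N D : ℕ} (hN : 2 < N) :
    Function.Injective (moment N : (Fin D → ℝ) → _) := by
  intro x y h
  have := map_eq_of_sum_moment_eq (N := N) ({()} : Finset Unit) ({()} : Finset Unit)
    (fun _ => x) (fun _ => y) (fun _ => 1) (by simp) (by simp) (by simpa using hN) (by simp [h])
  simpa using this

/-! ### Multisets of colors -/

/-- Equality of multisets matches the two families up to equal labels, and the matching survives any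
coarser labelling. The implication compares the two families with each other, so no function between
the label types has to be produced. -/
theorem map_eq_map_of_imp {ι κ α β : Type*} {s : Multiset ι} {t : Multiset κ} {p : ι → α}
    {q : κ → α} {p' : ι → β} {q' : κ → β} (h : s.map p = t.map q)
    (himp : ∀ i j, p i = q j → p' i = q' j) : s.map p' = t.map q' := by
  rw [← Multiset.rel_eq, Multiset.rel_map] at h ⊢
  exact h.mono fun i _ j _ hij => himp i j hij

theorem mset_eq_toLex {ι α : Type} (s : Finset ι) (f : ι → α) :
    mset s f = toLex ((s.val.map f).map fun c => Finsupp.single c 1).sum := by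
  rw [Multiset.map_map]
  rfl

theorem mset_apply {ι α : Type} [DecidableEq α] (s : Finset ι) (f : ι → α) (c : α) :
    ofLex (mset s f) c = (s.filter fun a => f a = c).card := by
  classical
  rw [mset, ofLex_toLex, Finsupp.finsetSum_apply, Finset.card_filter]
  exact Finset.sum_congr rfl fun a _ => by rw [Finsupp.single_apply]

theorem mset_eq_iff {ι κ α : Type} {s : Finset ι} {t : Finset κ} {f : ι → α} {g : κ → α} :
    mset s f = mset t g ↔ s.val.map f = t.val.map g := by
  classical
  constructor
  · intro h
    ext c
    have h1 := congrArg (fun M : MultisetLex α => ofLex M c) h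
    simp only [mset_apply] at h1
    rw [Multiset.count_map, Multiset.count_map]
    simpa [Finset.card_def, Finset.filter_val, eq_comm] using h1
  · intro h
    rw [mset_eq_toLex, mset_eq_toLex, h]

theorem exists_mem_of_mset_eq {ι κ α : Type} {s : Finset ι} {t : Finset κ} {f : ι → α} {g : κ → α}
    (h : mset s f = mset t g) {i : ι} (hi : i ∈ s) : ∃ j ∈ t, g j = f i := by
  have h1 : f i ∈ t.val.map g := by
    rw [← mset_eq_iff.1 h]
    exact Multiset.mem_map_of_mem f hi
  simpa using h1

/-- Two families with the same multiset of values differ by a bijection of the indices. -/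
theorem exists_equiv_of_map_univ_eq {n : ℕ} {α : Type*} {f g : Fin n → α}
    (h : (Finset.univ : Finset (Fin n)).val.map f = (Finset.univ : Finset (Fin n)).val.map g) :
    ∃ σ : Equiv.Perm (Fin n), ∀ i, f i = g (σ i) := by
  classical
  -- Equal multiplicities make the fibers over each value equinumerous; bijections of the fibers
  -- glue to a permutation.
  have hfib : ∀ c, Nonempty ({i // f i = c} ≃ {i // g i = c}) := by
    intro c
    rw [← Fintype.card_eq, Fintype.card_subtype, Fintype.card_subtype]
    have h1 := congrArg (Multiset.count c) h
    rw [Multiset.count_map, Multiset.count_map] at h1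
    simpa [Finset.card_def, Finset.filter_val, eq_comm] using h1
  exact ⟨Equiv.ofFiberEquiv fun c => (hfib c).some, fun i => (Equiv.ofFiberEquiv_map _ i).symm⟩

end MILCQP

end

noncomputable section

namespace MILCQP

/-! ### A network that computes the WL colors -/

/-- Real coordinates on the lower bounds. -/
def lowerCode : LowerBound → ℝ × ℝ := Sum.elim (fun _ => (0, 0)) fun x => (1, x)

/-- Real coordinates on the upper bounds. -/
def upperCode : UpperBound → ℝ × ℝ := Sum.elim (fun x => (1, x)) fun _ => (0, 0)

theorem continuous_lowerCode : Continuous lowerCode :=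
  continuous_const.sumElim (by fun_prop)

theorem continuous_upperCode : Continuous upperCode :=
  Continuous.sumElim (by fun_prop) continuous_const

theorem lowerCode_injective : Function.Injective lowerCode := by
  rintro (⟨⟩ | x) (⟨⟩ | y) h <;> simp [lowerCode] at h ⊢
  exact h

theorem upperCode_injective : Function.Injective upperCode := by
  rintro (x | ⟨⟩) (y | ⟨⟩) h <;> simp [upperCode] at h ⊢
  exact h

/-- Real coordinates on the features of the constraint nodes. -/
def conCode (v : ConFeature) : Fin 2 → ℝ := ![v.1, v.2.code]

/-- Real coordinates on the features of the variable nodes. -/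
def varCode (w : VarFeature) : Fin 6 → ℝ :=
  ![w.1, (lowerCode w.2.1).1, (lowerCode w.2.1).2, (upperCode w.2.2.1).1, (upperCode w.2.2.1).2,
    w.2.2.2.toNat]

theorem continuous_conCode : Continuous conCode := by
  have h : Continuous fun r : Rel => (r.code : ℝ) := continuous_of_discreteTopology
  have h' : Continuous fun v : ConFeature => (v.2.code : ℝ) := h.comp continuous_snd
  refine continuous_pi fun i => ?_
  fin_cases i
  · exact continuous_fst
  · exact h'

theorem continuous_varCode : Continuous varCode := by
  have hl : Continuous fun w : VarFeature => lowerCode w.2.1 :=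
    continuous_lowerCode.comp (by fun_prop)
  have hu : Continuous fun w : VarFeature => upperCode w.2.2.1 :=
    continuous_upperCode.comp (by fun_prop)
  have h : Continuous fun d : Bool => (d.toNat : ℝ) := continuous_of_discreteTopology
  have hd : Continuous fun w : VarFeature => (w.2.2.2.toNat : ℝ) := h.comp (by fun_prop)
  refine continuous_pi fun i => ?_
  fin_cases i
  · exact continuous_fst
  · exact hl.fst
  · exact hl.snd
  · exact hu.fst
  · exact hu.snd
  · exact hd

theorem conCode_injective : Function.Injective conCode := by
  rintro ⟨b, r⟩ ⟨b', r'⟩ h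
  have h0 := congrFun h 0
  have h1 := congrFun h 1
  simp only [conCode, Matrix.cons_val_zero, Matrix.cons_val_one, Nat.cast_inj] at h0 h1
  rw [h0, Rel.code_injective h1]

theorem varCode_injective : Function.Injective varCode := by
  rintro ⟨c, l, u, d⟩ ⟨c', l', u', d'⟩ h
  have h0 : c = c' := congrFun h 0
  have hl : l = l' := lowerCode_injective (Prod.ext (congrFun h 1) (congrFun h 2))
  have hu : u = u' := upperCode_injective (Prod.ext (congrFun h 3) (congrFun h 4))
  have h5 : (d.toNat : ℝ) = d'.toNat := congrFun h 5
  have hd : d = d' := by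
    cases d <;> cases d' <;> simp at h5 ⊢
  rw [h0, hl, hu, hd]

/-- The message sent along an edge of weight `p.2`: it vanishes when the weight does. -/
def edgeMessage (N : ℕ) {d : ℕ} (p : (Fin d → ℝ) × ℝ) : Fin (N ^ (d + 1)) → ℝ :=
  p.2 • moment N (Matrix.vecCons p.2 p.1)

theorem continuous_edgeMessage (N d : ℕ) :
    Continuous (edgeMessage N : (Fin d → ℝ) × ℝ → _) :=
  continuous_snd.smul ((continuous_moment N (d + 1)).comp
    (continuous_snd.matrixVecCons continuous_fst))

theorem edgeMessage_zero (N : ℕ) {d : ℕ} (t : Fin d → ℝ) : edgeMessage N (t, 0) = 0 := by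
  simp [edgeMessage]

theorem continuous_append {X : Type*} [TopologicalSpace X] {a b : ℕ} {f : X → Fin a → ℝ}
    {g : X → Fin b → ℝ} (hf : Continuous f) (hg : Continuous g) :
    Continuous fun x => Fin.append (f x) (g x) := by
  refine continuous_pi fun i => ?_
  refine Fin.addCases (fun i => ?_) (fun i => ?_) i
  · simp only [Fin.append_left]
    fun_prop
  · simp only [Fin.append_right]
    fun_prop

theorem append_inj {a b : ℕ} {x x' : Fin a → ℝ} {y y' : Fin b → ℝ}
    (h : Fin.append x y = Fin.append x' y') : x = x' ∧ y = y' := by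
  constructor
  · ext i
    simpa using congrFun h (Fin.castAdd b i)
  · ext i
    simpa using congrFun h (Fin.natAdd a i)

/-- The dimensions of the features of the constraint nodes and the variable nodes. -/
def featureDim (N : ℕ) : ℕ → ℕ × ℕ
  | 0 => (2, 6)
  | k + 1 =>
    (N ^ ((featureDim N k).1 + N ^ ((featureDim N k).2 + 1)),
      N ^ ((featureDim N k).2 + (N ^ ((featureDim N k).1 + 1) + N ^ ((featureDim N k).2 + 1))))

/-- The argument of the readout. -/
abbrev ReadoutSpace (N L : ℕ) : Type :=
  (Fin (featureDim N L).1 → ℝ) × (Fin (featureDim N L).2 → ℝ) × (Fin (featureDim N L).2 → ℝ)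

/-- A network whose features are moments of the messages, with readout `r`. -/
def momentGNN (N L : ℕ) (r : C(ReadoutSpace N L, ℝ)) : GNN where
  L := L
  dV k := (featureDim N k).1
  dW k := (featureDim N k).2
  eV k := N ^ ((featureDim N k).1 + 1)
  eW k := N ^ ((featureDim N k).2 + 1)
  eQ k := N ^ ((featureDim N k).2 + 1)
  f0V := conCode
  f0W := varCode
  -- Ending each layer with `moment N` loses nothing, as it is injective for `N > 2`, and turns the
  -- sum over all nodes in the readout into a sum of moments, which determines a multiset.
  fV _ p := moment N (Fin.append p.1 p.2)
  fW _ p := moment N (Fin.append p.1 (Fin.append p.2.1 p.2.2))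
  gV _ := edgeMessage N
  gW _ := edgeMessage N
  gQ _ := edgeMessage N
  r := r
  continuous_f0V := continuous_conCode
  continuous_f0W := continuous_varCode
  continuous_fV _ := (continuous_moment N _).comp (continuous_append continuous_fst continuous_snd)
  continuous_fW _ := (continuous_moment N _).comp (continuous_append continuous_fst
    (continuous_append continuous_snd.fst continuous_snd.snd))
  continuous_gV _ := continuous_edgeMessage N _
  continuous_gW _ := continuous_edgeMessage N _
  continuous_gQ _ := continuous_edgeMessage N _
  continuous_r := r.continuous

variable {m n : ℕ}

/-- The features of the constraint nodes and of the variable nodes in `momentGNN`. -/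
def momentFeatures (N : ℕ) (G : Graph m n) :
    (k : ℕ) → (Fin m → Fin (featureDim N k).1 → ℝ) × (Fin n → Fin (featureDim N k).2 → ℝ)
  | 0 => (fun i => conCode (G.conFeature i), fun j => varCode (G.varFeature j))
  | k + 1 =>
    (fun i => moment N (Fin.append ((momentFeatures N G k).1 i)
        (∑ j ∈ G.nbrVW i, edgeMessage N ((momentFeatures N G k).2 j, G.A i j))),
      fun j => moment N (Fin.append ((momentFeatures N G k).2 j)
        (Fin.append (∑ i ∈ G.nbrWV j, edgeMessage N ((momentFeatures N G k).1 i, G.A i j))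
          (∑ j' ∈ G.nbrWW j, edgeMessage N ((momentFeatures N G k).2 j', G.Q j j')))))

/-- The features do not involve the readout, so their continuity and separation power can be studied
before `r` is chosen. -/
theorem features_momentGNN (N L : ℕ) (r : C(ReadoutSpace N L, ℝ)) (G : Graph m n) (k : ℕ) :
    (momentGNN N L r).features G k = momentFeatures N G k := by
  induction k with
  | zero => rfl
  | succ k ih => simp only [GNN.features, momentFeatures, ih]; rfl

/-! ### Separation power of the network -/

/-- Sums of messages over edges determine the multiset of the edges. -/
theorem map_eq_of_sum_edgeMessage_eq {ι κ : Type} {N d : ℕ} (s : Finset ι) (t : Finset κ)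
    (p : ι → Fin d → ℝ) (q : κ → Fin d → ℝ) (a : ι → ℝ) (b : κ → ℝ)
    (ha : ∀ i ∈ s, a i ≠ 0) (hb : ∀ i ∈ t, b i ≠ 0) (hN : s.card + t.card < N)
    (h : ∑ i ∈ s, edgeMessage N (p i, a i) = ∑ i ∈ t, edgeMessage N (q i, b i)) :
    s.val.map (fun i => (p i, a i)) = t.val.map fun i => (q i, b i) := by
  -- The edge weight is coordinate 0 of the point, so the prefactor of the message is the function
  -- `x ↦ x 0` of that point, nonzero on edges.
  have h1 := map_eq_of_sum_moment_eq s t (fun i => Matrix.vecCons (a i) (p i))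
    (fun i => Matrix.vecCons (b i) (q i)) (fun x => x 0) ha hb hN h
  refine map_eq_map_of_imp h1 fun i j hij => ?_
  have h2 := congrFun hij 0
  have h3 : p i = q j := funext fun l => by simpa using congrFun hij l.succ
  simp only [Matrix.cons_val_zero] at h2
  rw [h2, h3]

theorem card_le_of_fin {l : ℕ} (s : Finset (Fin l)) : s.card ≤ l := by
  simpa using s.card_le_univ

theorem mset_eq_of_sum_edgeMessage_eq {ι κ α : Type} {N d : ℕ} {s : Finset ι} {t : Finset κ}
    {p : ι → Fin d → ℝ} {q : κ → Fin d → ℝ} {a : ι → ℝ} {b : κ → ℝ}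
    (ha : ∀ i ∈ s, a i ≠ 0) (hb : ∀ i ∈ t, b i ≠ 0) (hN : s.card + t.card < N)
    (h : ∑ i ∈ s, edgeMessage N (p i, a i) = ∑ i ∈ t, edgeMessage N (q i, b i))
    {f : ι → α} {g : κ → α} (hfg : ∀ i j, p i = q j → f i = g j) :
    (mset s fun i => (toLex (f i, a i) : α ×ₗ ℝ)) = mset t fun i => toLex (g i, b i) := by
  rw [mset_eq_iff]
  refine map_eq_map_of_imp (map_eq_of_sum_edgeMessage_eq s t p q a b ha hb hN h) fun i j hij => ?_
  rw [Prod.mk.injEq] at hij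
  rw [hfg i j hij.1, hij.2]

namespace Graph

theorem mem_nbrVW {G : Graph m n} {i : Fin m} {j : Fin n} : j ∈ G.nbrVW i ↔ G.A i j ≠ 0 := by
  simp [nbrVW]

theorem mem_nbrWV {G : Graph m n} {i : Fin m} {j : Fin n} : i ∈ G.nbrWV j ↔ G.A i j ≠ 0 := by
  simp [nbrWV]

theorem mem_nbrWW {G : Graph m n} {j j' : Fin n} : j' ∈ G.nbrWW j ↔ G.Q j j' ≠ 0 := by
  simp [nbrWW]

/-- The features of `momentGNN` are at least as fine as the WL colors. -/
theorem wlColors_eq_of_momentFeatures_eq {N : ℕ} (hN : 2 * (m + n) + 2 < N) (k : ℕ) :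
    (∀ (G G' : Graph m n) i i', (momentFeatures N G k).1 i = (momentFeatures N G' k).1 i' →
      (G.wlColors k).1 i = (G'.wlColors k).1 i') ∧
    ∀ (G G' : Graph m n) j j', (momentFeatures N G k).2 j = (momentFeatures N G' k).2 j' →
      (G.wlColors k).2 j = (G'.wlColors k).2 j' := by
  induction k with
  | zero =>
    constructor
    · intro G G' i i' h
      have h1 : (G.b i, G.rel i) = (G'.b i', G'.rel i') := conCode_injective h
      rw [Prod.mk.injEq] at h1
      simp only [wlColors, h1]
      rfl
    · intro G G' j j' h
      have h1 : (G.c j, G.l j, G.u j, G.isInt j) = (G'.c j', G'.l j', G'.u j', G'.isInt j') :=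
        varCode_injective h
      simp only [Prod.mk.injEq] at h1
      simp only [wlColors, h1]
      rfl
  | succ k ih =>
    -- The bound on `N` serves twice: for the injectivity of `moment N`, and for exceeding the joint
    -- size of two neighbourhoods, which is at most `2 * m` or `2 * n`.
    have hN' : 2 < N := by omega
    constructor
    · intro G G' i i' h
      obtain ⟨h1, h2⟩ := append_inj (moment_injective hN' h)
      have hc := card_le_of_fin (G.nbrVW i)
      have hc' := card_le_of_fin (G'.nbrVW i')
      have h3 := mset_eq_of_sum_edgeMessage_eq (fun _ => mem_nbrVW.1) (fun _ => mem_nbrVW.1)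
        (by omega) h2 (ih.2 G G')
      exact congrArg₂ (fun x y => toLex (x, y)) (ih.1 G G' i i' h1) h3
    · intro G G' j j' h
      obtain ⟨h1, h2⟩ := append_inj (moment_injective hN' h)
      obtain ⟨h2, h3⟩ := append_inj h2
      have hc := card_le_of_fin (G.nbrWV j)
      have hc' := card_le_of_fin (G'.nbrWV j')
      have hd := card_le_of_fin (G.nbrWW j)
      have hd' := card_le_of_fin (G'.nbrWW j')
      have h4 := mset_eq_of_sum_edgeMessage_eq (fun _ => mem_nbrWV.1) (fun _ => mem_nbrWV.1)
        (by omega) h2 (ih.1 G G')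
      have h5 := mset_eq_of_sum_edgeMessage_eq (fun _ => mem_nbrWW.1) (fun _ => mem_nbrWW.1)
        (by omega) h3 (ih.2 G G')
      exact congrArg₂ (fun x y => toLex (x, y)) (ih.2 G G' j j' h1)
        (congrArg₂ (fun x y => toLex (x, y)) h4 h5)

/-! ### Isomorphisms of graphs -/

/-- The permutations `π` of the constraint nodes and `σ` of the variable nodes form an isomorphism
of `G` onto `G'`. -/
structure IsIso (G G' : Graph m n) (π : Equiv.Perm (Fin m)) (σ : Equiv.Perm (Fin n)) : Prop where
  A : ∀ i j, G.A i j = G'.A (π i) (σ j)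
  Q : ∀ j j', G.Q j j' = G'.Q (σ j) (σ j')
  b : ∀ i, G.b i = G'.b (π i)
  rel : ∀ i, G.rel i = G'.rel (π i)
  c : ∀ j, G.c j = G'.c (σ j)
  l : ∀ j, G.l j = G'.l (σ j)
  u : ∀ j, G.u j = G'.u (σ j)
  isInt : ∀ j, G.isInt j = G'.isInt (σ j)

end Graph

theorem mset_equiv {ι κ α : Type} (e : ι ≃ κ) {s : Finset ι} {t : Finset κ} {f : ι → α}
    {g : κ → α} (hst : ∀ i, i ∈ s ↔ e i ∈ t) (hfg : ∀ i, f i = g (e i)) : mset s f = mset t g :=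
  congrArg toLex (Finset.sum_equiv e hst fun i _ => by rw [hfg])

namespace Graph.IsIso

variable {G G' : Graph m n} {π : Equiv.Perm (Fin m)} {σ : Equiv.Perm (Fin n)}

theorem wlColors_eq (h : IsIso G G' π σ) (k : ℕ) :
    (∀ i, (G.wlColors k).1 i = (G'.wlColors k).1 (π i)) ∧
      ∀ j, (G.wlColors k).2 j = (G'.wlColors k).2 (σ j) := by
  induction k with
  | zero =>
    constructor
    · intro i
      simp only [wlColors, h.b i, h.rel i]
      rfl
    · intro j
      simp only [wlColors, h.c j, h.l j, h.u j, h.isInt j]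
      rfl
  | succ k ih =>
    constructor
    · intro i
      refine congrArg₂ (fun x y => toLex (x, y)) (ih.1 i) (mset_equiv σ (fun j => ?_) fun j => ?_)
      · rw [mem_nbrVW, mem_nbrVW, h.A]
      · rw [ih.2, h.A]
    · intro j
      refine congrArg₂ (fun x y => toLex (x, y)) (ih.2 j) (congrArg₂ (fun x y => toLex (x, y))
        (mset_equiv π (fun i => ?_) fun i => ?_) (mset_equiv σ (fun j' => ?_) fun j' => ?_))
      · rw [mem_nbrWV, mem_nbrWV, h.A]
      · rw [ih.1, h.A]
      · rw [mem_nbrWW, mem_nbrWW, h.Q]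
      · rw [ih.2, h.Q]

theorem varLT_iff (h : IsIso G G' π σ) (j j' : Fin n) :
    G.VarLT j j' ↔ G'.VarLT (σ j) (σ j') := by
  simp only [VarLT, colorW, (h.wlColors_eq _).2]

/-- The relabelling of the coordinates. -/
abbrev relabel (σ : Equiv.Perm (Fin n)) :
    EuclideanSpace ℝ (Fin n) ≃ₗᵢ[ℝ] EuclideanSpace ℝ (Fin n) :=
  LinearIsometryEquiv.piLpCongrLeft 2 ℝ ℝ σ

theorem relabel_apply (σ : Equiv.Perm (Fin n)) (x : EuclideanSpace ℝ (Fin n)) (j : Fin n) :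
    relabel σ x (σ j) = x j := by
  simp [relabel, LinearIsometryEquiv.piLpCongrLeft_apply]

theorem feasible_iff (h : IsIso G G' π σ) (x : EuclideanSpace ℝ (Fin n)) :
    G.Feasible x ↔ G'.Feasible (relabel σ x) := by
  have hA : ∀ i, ∑ j, G'.A (π i) j * relabel σ x j = ∑ j, G.A i j * x j := fun i => by
    rw [← Equiv.sum_comp σ]
    simp only [relabel_apply, h.A]
  refine and_congr (π.forall_congr fun i => ?_) (and_congr (σ.forall_congr fun j => ?_)
    (and_congr (σ.forall_congr fun j => ?_) (σ.forall_congr fun j => ?_)))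
  · rw [hA, h.rel, h.b]
  · rw [relabel_apply, h.l]
  · rw [relabel_apply, h.u]
  · rw [relabel_apply, h.isInt]

theorem objective_eq (h : IsIso G G' π σ) (x : EuclideanSpace ℝ (Fin n)) :
    G.objective x = G'.objective (relabel σ x) := by
  have hQ : ∑ j, ∑ j', relabel σ x j * G'.Q j j' * relabel σ x j' =
      ∑ j, ∑ j', x j * G.Q j j' * x j' := by
    rw [← Equiv.sum_comp σ]
    refine Finset.sum_congr rfl fun j _ => ?_
    rw [← Equiv.sum_comp σ]
    simp only [relabel_apply, h.Q]
  have hc : ∑ j, G'.c j * relabel σ x j = ∑ j, G.c j * x j := by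
    rw [← Equiv.sum_comp σ]
    simp only [relabel_apply, h.c]
  rw [objective, objective, hQ, hc]

theorem isOptimal_iff (h : IsIso G G' π σ) (x : EuclideanSpace ℝ (Fin n)) :
    G.IsOptimal x ↔ G'.IsOptimal (relabel σ x) := by
  refine and_congr (h.feasible_iff x) ((relabel σ).toEquiv.forall_congr fun y => ?_)
  exact imp_congr (h.feasible_iff y) (by rw [h.objective_eq x, h.objective_eq y]; rfl)

theorem solLT_iff (h : IsIso G G' π σ) (x y : EuclideanSpace ℝ (Fin n)) :
    G.SolLT x y ↔ G'.SolLT (relabel σ x) (relabel σ y) := by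
  unfold SolLT
  rw [LinearIsometryEquiv.norm_map, LinearIsometryEquiv.norm_map]
  refine or_congr_right (and_congr_right fun _ => σ.exists_congr fun j => and_congr
    (σ.forall_congr fun j' => ?_) ?_)
  · rw [relabel_apply, relabel_apply, h.varLT_iff]
  · rw [relabel_apply, relabel_apply]

/-- Relabelling is an isometry that preserves optimality and the order of the nodes, so it carries
the least optimal solution to a least optimal one; uniqueness for `G'` does the rest. -/
theorem solMap_eq (h : IsIso G G' π σ) (hG : G.Unfoldable) (hS : ∃ x, G.IsOptimal x)
    (hG' : G'.Unfoldable) (j : Fin n) : G.solMap j = G'.solMap (σ j) := by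
  have h1 := G.solMap_isLeastOptimal hG hS
  have h2 : G'.IsLeastOptimal (relabel σ G.solMap) := by
    refine ⟨(h.isOptimal_iff _).1 h1.1, (relabel σ).surjective.forall.2 fun y hy hne => ?_⟩
    exact (h.solLT_iff _ _).1 (h1.2 y ((h.isOptimal_iff _).2 hy) fun he => hne (by rw [he]))
  have hS' : ∃ x, G'.IsOptimal x := ⟨_, h2.1⟩
  have h3 := (G'.existsUnique_isLeastOptimal hG' hS').unique h2 (G'.solMap_isLeastOptimal hG' hS')
  rw [← h3, relabel_apply]

end Graph.IsIso

end MILCQP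

end

noncomputable section

namespace MILCQP

variable {m n : ℕ}

namespace Graph

/-! ### Continuity of the features -/

theorem continuous_data : Continuous (data : Graph m n → _) := continuous_induced_dom

theorem continuous_A (i : Fin m) (j : Fin n) : Continuous fun G : Graph m n => G.A i j :=
  (continuous_fst.comp continuous_data).matrix_elem i j

theorem continuous_Q (j j' : Fin n) : Continuous fun G : Graph m n => G.Q j j' :=
  (continuous_snd.fst.comp continuous_data).matrix_elem j j'

theorem continuous_b (i : Fin m) : Continuous fun G : Graph m n => G.b i :=
  (continuous_apply i).comp (continuous_snd.snd.fst.comp continuous_data)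

theorem continuous_rel (i : Fin m) : Continuous fun G : Graph m n => G.rel i :=
  (continuous_apply i).comp (continuous_snd.snd.snd.fst.comp continuous_data)

theorem continuous_c (j : Fin n) : Continuous fun G : Graph m n => G.c j :=
  (continuous_apply j).comp (continuous_snd.snd.snd.snd.fst.comp continuous_data)

theorem continuous_l (j : Fin n) : Continuous fun G : Graph m n => G.l j :=
  (continuous_apply j).comp (continuous_snd.snd.snd.snd.snd.fst.comp continuous_data)

theorem continuous_u (j : Fin n) : Continuous fun G : Graph m n => G.u j :=
  (continuous_apply j).comp (continuous_snd.snd.snd.snd.snd.snd.fst.comp continuous_data)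

theorem continuous_isInt (j : Fin n) : Continuous fun G : Graph m n => G.isInt j :=
  (continuous_apply j).comp (continuous_snd.snd.snd.snd.snd.snd.snd.comp continuous_data)

end Graph

/-- Non-edges contribute zero messages. The index set thus becomes independent of the graph, which
gives continuity even where an entry of `A` or `Q` passes through zero. -/
theorem sum_edgeMessage_eq {ι : Type*} [Fintype ι] {N d : ℕ} (s : Finset ι) (t : ι → Fin d → ℝ)
    (a : ι → ℝ) (hs : ∀ i, i ∈ s ↔ a i ≠ 0) :
    ∑ i ∈ s, edgeMessage N (t i, a i) = ∑ i, edgeMessage N (t i, a i) := by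
  refine Finset.sum_subset (Finset.subset_univ s) fun i _ hi => ?_
  rw [not_not.1 ((hs i).not.1 hi), edgeMessage_zero]

theorem continuous_sum_edgeMessage {X ι : Type*} [TopologicalSpace X] [Fintype ι] {N d : ℕ}
    {t : ι → X → Fin d → ℝ} {a : ι → X → ℝ} (ht : ∀ i, Continuous (t i))
    (ha : ∀ i, Continuous (a i)) :
    Continuous fun x => ∑ i, edgeMessage N (t i x, a i x) :=
  continuous_finsetSum _ fun i _ =>
    (continuous_edgeMessage N d).comp ((ht i).prodMk (ha i))

theorem continuous_momentFeatures (N k : ℕ) :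
    (∀ i, Continuous fun G : Graph m n => (momentFeatures N G k).1 i) ∧
      ∀ j, Continuous fun G : Graph m n => (momentFeatures N G k).2 j := by
  induction k with
  | zero =>
    exact ⟨fun i => continuous_conCode.comp ((Graph.continuous_b i).prodMk (Graph.continuous_rel i)),
      fun j => continuous_varCode.comp ((Graph.continuous_c j).prodMk ((Graph.continuous_l j).prodMk
        ((Graph.continuous_u j).prodMk (Graph.continuous_isInt j))))⟩
  | succ k ih =>
    constructor
    · intro i
      refine (continuous_moment N _).comp (continuous_append (ih.1 i) ?_)
      simp_rw [sum_edgeMessage_eq _ _ _ fun _ => Graph.mem_nbrVW]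
      exact continuous_sum_edgeMessage ih.2 (Graph.continuous_A i)
    · intro j
      refine (continuous_moment N _).comp (continuous_append (ih.2 j) (continuous_append ?_ ?_))
      · simp_rw [sum_edgeMessage_eq _ _ _ fun _ => Graph.mem_nbrWV]
        exact continuous_sum_edgeMessage ih.1 fun i => Graph.continuous_A i j
      · simp_rw [sum_edgeMessage_eq _ _ _ fun _ => Graph.mem_nbrWW]
        exact continuous_sum_edgeMessage ih.2 (Graph.continuous_Q j)

/-! ### The readout -/

/-- The argument of the readout of `momentGNN` at the variable node `j`. -/
def readoutArg (N L : ℕ) (G : Graph m n) (j : Fin n) : ReadoutSpace N L :=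
  (∑ i, (momentFeatures N G L).1 i, ∑ j', (momentFeatures N G L).2 j', (momentFeatures N G L).2 j)

theorem output_momentGNN (N L : ℕ) (r : C(ReadoutSpace N L, ℝ)) (G : Graph m n) (j : Fin n) :
    (momentGNN N L r).output G j = r (readoutArg N L G j) := by
  simp only [GNN.output, features_momentGNN]
  rfl

theorem continuous_readoutArg (N L : ℕ) :
    Continuous fun p : Graph m n × Fin n => readoutArg N L p.1 p.2 := by
  refine continuous_prod_of_discrete_right.2 fun j => ?_
  have h := continuous_momentFeatures (m := m) (n := n) N L
  exact (continuous_finsetSum _ fun i _ => h.1 i).prodMk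
    ((continuous_finsetSum _ fun j _ => h.2 j).prodMk (h.2 j))

/-- The graphs whose variable nodes have different colors after `K` iterations. -/
def separatedAt (m n K : ℕ) : Set (Graph m n) := {G | ∀ j j', G.colorW K j = G.colorW K j' → j = j'}

theorem separatedAt_subset_unfoldable (m n K : ℕ) : separatedAt m n K ⊆ unfoldable m n :=
  fun _ hG j j' h => hG j j' (h K)

/-- This recovers a matching of nodes from the global sums in the readout: the features of a layer
after the initial one are moments, with `p` and `q` the arguments of the last `moment N`. -/
theorem map_univ_eq_of_sum_moment_eq {l N D : ℕ} (hN : 2 * l < N) {α : Type*}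
    (p q : Fin l → Fin D → ℝ) (h : ∑ i, moment N (p i) = ∑ i, moment N (q i)) {f g : Fin l → α}
    (hfg : ∀ i j, moment N (p i) = moment N (q j) → f i = g j) :
    ∃ σ : Equiv.Perm (Fin l), ∀ i, f i = g (σ i) := by
  refine exists_equiv_of_map_univ_eq (map_eq_map_of_imp (map_eq_of_sum_moment_eq Finset.univ
    Finset.univ p q (fun _ => 1) (by simp) (by simp) ?_ (by simpa using h)) fun i j hij =>
      hfg i j (congrArg _ hij))
  simp only [Finset.card_univ, Fintype.card_fin]
  omega

/-- As `f` is injective, a pair with color `f i` can only come from the index `i`, so the multiset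
of pairs is the graph of the weight function on its support. -/
theorem weight_eq_of_mset_eq {ι α : Type} {s t : Finset ι} {f g : ι → α} {a b : ι → ℝ}
    (hs : ∀ i, i ∈ s ↔ a i ≠ 0) (ht : ∀ i, i ∈ t ↔ b i ≠ 0) (hf : Function.Injective f)
    (hfg : ∀ i, f i = g i)
    (h : (mset s fun i => (toLex (f i, a i) : α ×ₗ ℝ)) = mset t fun i => toLex (g i, b i)) (i : ι) :
    a i = b i := by
  obtain rfl : f = g := funext hfg
  by_cases hi : i ∈ s
  · obtain ⟨j, -, hj⟩ := exists_mem_of_mset_eq h hi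
    have hj' := congrArg ofLex hj
    simp only [ofLex_toLex, Prod.mk.injEq] at hj'
    rw [← hj'.2, hf hj'.1]
  · by_cases hi' : i ∈ t
    · obtain ⟨j, -, hj⟩ := exists_mem_of_mset_eq h.symm hi'
      have hj' := congrArg ofLex hj
      simp only [ofLex_toLex, Prod.mk.injEq] at hj'
      rw [← hj'.2, hf hj'.1]
    · rw [not_not.1 ((hs i).not.1 hi), not_not.1 ((ht i).not.1 hi')]

/-- The color of a node in round `K + 1` lists the weights of its edges against the round-`K` colors
of its neighbours. Those of the variable nodes are pairwise distinct, so each row of `A` and of `Q`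
can be read off. The constraint nodes need not be distinguished. -/
theorem Graph.isIso_of_wlColors_eq {G G' : Graph m n} {K : ℕ} (hG : G ∈ separatedAt m n K)
    {π : Equiv.Perm (Fin m)} {σ : Equiv.Perm (Fin n)}
    (hπ : ∀ i, (G.wlColors (K + 1)).1 i = (G'.wlColors (K + 1)).1 (π i))
    (hσ : ∀ j, (G.wlColors (K + 1)).2 j = (G'.wlColors (K + 1)).2 (σ j)) :
    G.IsIso G' π σ := by
  have hπ' : ∀ i, (G.wlColors K).1 i = (G'.wlColors K).1 (π i) := fun i =>
    congrArg (fun x : (colorSpace K).V ×ₗ MultisetLex ((colorSpace K).W ×ₗ ℝ) => (ofLex x).1) (hπ i)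
  have hσ' : ∀ j, (G.wlColors K).2 j = (G'.wlColors K).2 (σ j) := fun j =>
    congrArg (fun x : (colorSpace K).W ×ₗ MultisetLex ((colorSpace K).V ×ₗ ℝ) ×ₗ
        MultisetLex ((colorSpace K).W ×ₗ ℝ) => (ofLex x).1) (hσ j)
  -- Each color contains its predecessor as first component, so descending to round 0 recovers the
  -- features.
  have h0 : ∀ k, (∀ i, (G.wlColors k).1 i = (G'.wlColors k).1 (π i)) →
      (∀ j, (G.wlColors k).2 j = (G'.wlColors k).2 (σ j)) →
      (∀ i, (G.wlColors 0).1 i = (G'.wlColors 0).1 (π i)) ∧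
      ∀ j, (G.wlColors 0).2 j = (G'.wlColors 0).2 (σ j) := by
    intro k
    induction k with
    | zero => exact fun h h' => ⟨h, h'⟩
    | succ k ih =>
      exact fun h h' => ih
        (fun i => congrArg (fun x : (colorSpace k).V ×ₗ MultisetLex ((colorSpace k).W ×ₗ ℝ) =>
          (ofLex x).1) (h i))
        (fun j => congrArg (fun x : (colorSpace k).W ×ₗ MultisetLex ((colorSpace k).V ×ₗ ℝ) ×ₗ
          MultisetLex ((colorSpace k).W ×ₗ ℝ) => (ofLex x).1) (h' j))
  obtain ⟨hV, hW⟩ := h0 K hπ' hσ'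
  have hV' : ∀ i, (G.b i, G.rel i) = (G'.b (π i), G'.rel (π i)) := hV
  have hW' : ∀ j, (G.c j, G.l j, G.u j, G.isInt j) =
      (G'.c (σ j), G'.l (σ j), G'.u (σ j), G'.isInt (σ j)) := hW
  simp only [Prod.mk.injEq] at hV' hW'
  have hA : ∀ i j, G.A i j = G'.A (π i) (σ j) := by
    intro i
    have h1 : (mset (G.nbrVW i) fun j => (toLex ((G.wlColors K).2 j, G.A i j) :
        (colorSpace K).W ×ₗ ℝ)) = mset (G'.nbrVW (π i)) fun j =>
          toLex ((G'.wlColors K).2 j, G'.A (π i) j) :=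
      congrArg (fun x : (colorSpace K).V ×ₗ MultisetLex ((colorSpace K).W ×ₗ ℝ) => (ofLex x).2)
        (hπ i)
    -- The neighbourhood in `G'` is pulled back along `σ`, so that both multisets are indexed by the
    -- nodes of `G`.
    refine weight_eq_of_mset_eq (t := (G'.nbrVW (π i)).map σ.symm.toEmbedding)
      (fun _ => mem_nbrVW) (fun j => ?_) hG hσ' (h1.trans ?_)
    · rw [Finset.mem_map_equiv, Equiv.symm_symm, mem_nbrVW]
    · exact mset_equiv σ.symm (fun j => by simp) fun j => by simp
  have hQ : ∀ j j', G.Q j j' = G'.Q (σ j) (σ j') := by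
    intro j
    have h1 : (mset (G.nbrWW j) fun j' => (toLex ((G.wlColors K).2 j', G.Q j j') :
        (colorSpace K).W ×ₗ ℝ)) = mset (G'.nbrWW (σ j)) fun j' =>
          toLex ((G'.wlColors K).2 j', G'.Q (σ j) j') :=
      congrArg (fun x : (colorSpace K).W ×ₗ MultisetLex ((colorSpace K).V ×ₗ ℝ) ×ₗ
        MultisetLex ((colorSpace K).W ×ₗ ℝ) => (ofLex (ofLex x).2).2) (hσ j)
    refine weight_eq_of_mset_eq (t := (G'.nbrWW (σ j)).map σ.symm.toEmbedding)
      (fun _ => mem_nbrWW) (fun j' => ?_) hG hσ' (h1.trans ?_)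
    · rw [Finset.mem_map_equiv, Equiv.symm_symm, mem_nbrWW]
    · exact mset_equiv σ.symm (fun j => by simp) fun j => by simp
  exact ⟨hA, hQ, fun i => (hV' i).1, fun i => (hV' i).2, fun j => (hW' j).1, fun j => (hW' j).2.1,
    fun j => (hW' j).2.2.1, fun j => (hW' j).2.2.2⟩

/-- The argument of the readout determines the entry of the optimal solution. -/
theorem solMap_eq_of_readoutArg_eq {N K : ℕ} (hN : 2 * (m + n) + 2 < N) {G G' : Graph m n}
    (hG : G ∈ solvable m n ∩ separatedAt m n K) (hG' : G' ∈ solvable m n ∩ separatedAt m n K)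
    {j j' : Fin n} (h : readoutArg N (K + 1) G j = readoutArg N (K + 1) G' j') :
    G.solMap j = G'.solMap j' := by
  obtain ⟨hcV, hcW⟩ := Graph.wlColors_eq_of_momentFeatures_eq hN (K + 1)
  simp only [readoutArg, Prod.mk.injEq] at h
  obtain ⟨hV, hW, hj⟩ := h
  obtain ⟨π, hπ⟩ := map_univ_eq_of_sum_moment_eq (by omega) _ _ hV (hcV G G')
  obtain ⟨σ, hσ⟩ := map_univ_eq_of_sum_moment_eq (by omega) _ _ hW (hcW G G')
  have hiso := Graph.isIso_of_wlColors_eq hG.2 hπ hσ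
  -- The permutation `σ` comes from the global sums and is not tied to `j'`. The node's own feature
  -- shows that `σ j` and `j'` have the same color, and separation of `G'` identifies them.
  have hj' : G'.colorW (K + 1) (σ j) = G'.colorW (K + 1) j' :=
    (hσ j).symm.trans (hcW G G' j j' hj)
  have hj'' : σ j = j' := hG'.2 _ _ (congrArg (fun x : (colorSpace K).W ×ₗ MultisetLex
    ((colorSpace K).V ×ₗ ℝ) ×ₗ MultisetLex ((colorSpace K).W ×ₗ ℝ) => (ofLex x).1) hj')
  rw [hiso.solMap_eq (separatedAt_subset_unfoldable m n K hG.2) hG.1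
    (separatedAt_subset_unfoldable m n K hG'.2) j, hj'']

/-! ### Exact representation on compact sets -/

/-- A continuous function on a compact space that factors through a continuous map into a normal
space factors through it continuously. -/
theorem exists_continuousMap_comp_eq {Z Y : Type*} [TopologicalSpace Z] [CompactSpace Z]
    [TopologicalSpace Y] [T4Space Y] {E : Z → Y} (hE : Continuous E) {φ : Z → ℝ}
    (hφ : Continuous φ) (hfac : ∀ z z', E z = E z' → φ z = φ z') :
    ∃ r : C(Y, ℝ), ∀ z, r (E z) = φ z := by
  -- From a compact to a Hausdorff space, `E` is closed, hence a quotient map onto its range. So `φ`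
  -- descends to the range, which is closed, and Tietze's theorem extends it.
  have hq : Topology.IsQuotientMap (Set.rangeFactorization E) :=
    (hE.subtype_mk _).isClosedMap.isQuotientMap (hE.subtype_mk _) Set.rangeFactorization_surjective
  have hfac' : ∀ z z', Set.rangeFactorization E z = Set.rangeFactorization E z' →
      (⟨φ, hφ⟩ : C(Z, ℝ)) z = (⟨φ, hφ⟩ : C(Z, ℝ)) z' :=
    fun z z' h => hfac z z' (congrArg Subtype.val h)
  have hcl : IsClosed (Set.range E) := (isCompact_range hE).isClosed
  obtain ⟨r, hr⟩ := ContinuousMap.exists_restrict_eq hcl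
    (hq.lift (f := ⟨_, hq.continuous⟩) ⟨φ, hφ⟩ hfac')
  refine ⟨r, fun z => ?_⟩
  have h1 := congrArg (fun f : C(Set.range E, ℝ) => f (Set.rangeFactorization E z)) hr
  have h2 := congrArg (fun f : C(Z, ℝ) => f z)
    (hq.lift_comp (f := ⟨_, hq.continuous⟩) ⟨φ, hφ⟩ hfac')
  exact h1.trans h2

/-- A function of the variable nodes that is continuous on a compact set of graphs and determined
by the argument of the readout is computed by a network. -/
theorem exists_output_eq {N L : ℕ} {X : Set (Graph m n)} (hX : IsCompact X)
    {Φ : Graph m n → EuclideanSpace ℝ (Fin n)} (hcont : ContinuousOn Φ X)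
    (hfac : ∀ G ∈ X, ∀ G' ∈ X, ∀ j j', readoutArg N L G j = readoutArg N L G' j' →
      Φ G j = Φ G' j') :
    ∃ F : GNN, ∀ G ∈ X, F.output G = Φ G := by
  have : CompactSpace X := isCompact_iff_compactSpace.1 hX
  have hpair : Continuous fun p : X × Fin n => ((p.1 : Graph m n), p.2) := by fun_prop
  have hE : Continuous fun p : X × Fin n => readoutArg N L (p.1 : Graph m n) p.2 :=
    (continuous_readoutArg N L).comp hpair
  have hφ : Continuous fun p : X × Fin n => Φ p.1 p.2 := by
    refine continuous_prod_of_discrete_right.2 fun j => ?_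
    have h : Continuous fun x : EuclideanSpace ℝ (Fin n) => x j := by fun_prop
    exact h.comp (continuousOn_iff_continuous_domRestrict.1 hcont)
  obtain ⟨r, hr⟩ := exists_continuousMap_comp_eq hE hφ
    fun p q h => hfac p.1 p.1.2 q.1 q.1.2 p.2 q.2 h
  refine ⟨momentGNN N L r, fun G hG => PiLp.ext fun j => ?_⟩
  rw [output_momentGNN]
  exact hr (⟨G, hG⟩, j)

/-- On a compact set of graphs on which it is continuous, the optimal solution map is computed by
a network. -/
theorem exists_output_eq_solMap {K : ℕ} {X : Set (Graph m n)} (hX : IsCompact X)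
    (hsub : X ⊆ solvable m n ∩ separatedAt m n K)
    (hcont : ContinuousOn (fun G : Graph m n => G.solMap) X) :
    ∃ F : GNN, ∀ G ∈ X, F.output G = G.solMap :=
  -- Here `N` is the least value admitted by the separation lemma, and the layer after `K` is the
  -- one that reveals the edge weights.
  exists_output_eq (N := 2 * (m + n) + 3) (L := K + 1) hX hcont fun _ hG _ hG' _ _ h =>
    solMap_eq_of_readoutArg_eq (Nat.lt_succ_self _) (hsub hG) (hsub hG') h

end MILCQP

end

noncomputable section

namespace MILCQP

variable {m n : ℕ}

/-! ### The space of graphs is Polish -/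

theorem isClosed_posSemidef (n : ℕ) : IsClosed {M : Matrix (Fin n) (Fin n) ℝ | M.PosSemidef} := by
  simp only [Matrix.posSemidef_iff_dotProduct_mulVec, Set.ofPred_and, Set.ofPred_forall]
  refine IsClosed.inter ?_ (isClosed_iInter fun x => ?_)
  · exact isClosed_eq (continuous_id.matrix_conjTranspose) continuous_id
  · exact isClosed_le continuous_const
      (continuous_const.dotProduct (continuous_id.matrix_mulVec continuous_const))

theorem Graph.isClosedEmbedding_data : Topology.IsClosedEmbedding (data : Graph m n → _) := by
  refine ⟨⟨⟨rfl⟩, fun G G' h => ?_⟩, ?_⟩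
  · simp only [data, Prod.mk.injEq] at h
    ext1 <;> simp only [h]
  · have h : Set.range (data : Graph m n → _) = {p | p.2.1.PosSemidef} := by
      ext p
      constructor
      · rintro ⟨G, rfl⟩
        exact G.posSemidef
      · exact fun hp => ⟨⟨p.1, p.2.1, p.2.2.1, p.2.2.2.1, p.2.2.2.2.1, p.2.2.2.2.2.1,
          p.2.2.2.2.2.2.1, p.2.2.2.2.2.2.2, hp⟩, rfl⟩
    rw [h]
    exact (isClosed_posSemidef n).preimage continuous_snd.fst

-- On a Polish space finite Borel measures are inner regular for compact sets, which Lusin's theorem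
-- requires.
set_option synthInstance.maxHeartbeats 400000 in
set_option synthInstance.maxSize 1000 in
instance : PolishSpace (Graph m n) := by
  have : Countable Rel := Rel.code_injective.countable
  have : PolishSpace Rel := inferInstance
  have hM : ∀ k l, PolishSpace (Matrix (Fin k) (Fin l) ℝ) := fun k l =>
    inferInstanceAs (PolishSpace (Fin k → Fin l → ℝ))
  have := hM m n
  have := hM n n
  exact Graph.isClosedEmbedding_data.polishSpace

end MILCQP

/-! ### Lusin's theorem -/

open MeasureTheory in
/-- **Lusin's theorem** for a map that is measurable on `D`. -/
theorem exists_isCompact_continuousOn {X Y : Type*} [TopologicalSpace X] [T2Space X]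
    [MeasurableSpace X] [BorelSpace X] (μ : Measure X) [IsFiniteMeasure μ]
    [μ.InnerRegularCompactLTTop] [TopologicalSpace Y] [SecondCountableTopology Y] {D : Set X}
    {f : X → Y} (hf : ∀ U, IsOpen U → MeasurableSet (D ∩ f ⁻¹' U)) {ε : ENNReal} (hε : ε ≠ 0) :
    ∃ K ⊆ D, IsCompact K ∧ ContinuousOn f K ∧ μ (D \ K) < ε := by
  have hD : MeasurableSet D := by simpa using hf Set.univ isOpen_univ
  have hbasis := TopologicalSpace.isBasis_countableBasis Y
  -- The whole space is added to make the index set nonempty: its member of the intersection bounds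
  -- the latter by `D` and by a compact set.
  let I : Set (Set Y) := insert Set.univ (TopologicalSpace.countableBasis Y)
  have hI : Countable I :=
    ((TopologicalSpace.countable_countableBasis Y).insert _).to_subtype
  have hopen : ∀ U : I, IsOpen (U : Set Y) := by
    rintro ⟨U, rfl | hU⟩
    · exact isOpen_univ
    · exact hbasis.isOpen hU
  obtain ⟨δ, hδ, hsum⟩ := ENNReal.exists_pos_sum_of_countable' hε I
  have hδ2 : ∀ U, δ U / 2 ≠ 0 := fun U => (ENNReal.half_pos (hδ U).ne').ne'
  have hA := fun U : I => (hf U (hopen U)).exists_isCompact_sdiff_lt (measure_ne_top μ _) (hδ2 U)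
  have hB := fun U : I => (hD.diff (hf U (hopen U))).exists_isCompact_sdiff_lt
    (measure_ne_top μ _) (hδ2 U)
  choose A hAsub hAc hAm using hA
  choose B hBsub hBc hBm using hB
  have hT : ∀ U, IsCompact (A U ∪ B U) := fun U => (hAc U).union (hBc U)
  let U₀ : I := ⟨Set.univ, Set.mem_insert _ _⟩
  have hsub : ⋂ U, A U ∪ B U ⊆ D := (Set.iInter_subset _ U₀).trans
    (Set.union_subset ((hAsub U₀).trans Set.inter_subset_left)
      ((hBsub U₀).trans Set.sdiff_subset))
  refine ⟨⋂ U, A U ∪ B U, hsub, (hT U₀).of_isClosed_subset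
    (isClosed_iInter fun U => (hT U).isClosed) (Set.iInter_subset _ U₀), ?_, ?_⟩
  · intro x hx
    refine hbasis.nhds_hasBasis.tendsto_right_iff.2 fun V hV => ?_
    let V' : I := ⟨V, Set.mem_insert_of_mem _ hV.1⟩
    -- Within the intersection, a point outside `B V'` lies in `A V'` and is mapped into `V`. Since
    -- `B V'` is closed, avoiding it is an open condition.
    have hxB : x ∈ (B V')ᶜ := fun h => (hBsub V' h).2 ⟨hsub hx, hV.2⟩
    filter_upwards [self_mem_nhdsWithin, mem_nhdsWithin_of_mem_nhds
      ((hBc V').isClosed.isOpen_compl.mem_nhds hxB)] with y hy hyB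
    exact (hAsub V' ((Set.mem_iInter.1 hy V').resolve_right hyB)).2
  · refine lt_of_le_of_lt ?_ hsum
    have hcover : D \ ⋂ U, A U ∪ B U ⊆
        ⋃ U : I, ((D ∩ f ⁻¹' U) \ A U) ∪ ((D \ (D ∩ f ⁻¹' U)) \ B U) := by
      rintro x ⟨hxD, hx⟩
      simp only [Set.mem_iInter, not_forall, Set.mem_union, not_or] at hx
      obtain ⟨U, hxA, hxB⟩ := hx
      refine Set.mem_iUnion.2 ⟨U, ?_⟩
      by_cases hxU : x ∈ D ∩ f ⁻¹' U
      · exact Or.inl ⟨hxU, hxA⟩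
      · exact Or.inr ⟨⟨hxD, hxU⟩, hxB⟩
    refine (measure_mono hcover).trans ((measure_iUnion_le _).trans (ENNReal.tsum_le_tsum fun U => ?_))
    refine (measure_union_le _ _).trans ?_
    exact (add_le_add (hAm U).le (hBm U).le).trans_eq (ENNReal.add_halves _)

/-! ### Measurability of minimizers -/

/-- The minimizers of `f` on `S`. -/
def argminOn {E : Type*} (f : E → ℝ) (S : Set E) : Set E := {x | x ∈ S ∧ ∀ y ∈ S, f x ≤ f y}

theorem isClosed_argminOn {E : Type*} [TopologicalSpace E] {f : E → ℝ} (hf : Continuous f)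
    {S : Set E} (hS : IsClosed S) : IsClosed (argminOn f S) := by
  have h : argminOn f S = S ∩ ⋂ y ∈ S, {x | f x ≤ f y} := by
    ext x
    simp [argminOn]
  rw [h]
  exact hS.inter (isClosed_biInter fun y _ => isClosed_le hf continuous_const)

/-- If the sublevel sets of `f z` on `S z` hit compact sets measurably in `z`, then so do the
minimizers. -/
theorem measurableSet_argminOn_hits {Z E : Type*} [MeasurableSpace Z] [TopologicalSpace E]
    [SigmaCompactSpace E] {S : Z → Set E} (hS : ∀ z, IsClosed (S z)) {f : Z → E → ℝ}
    (hf : ∀ z, Continuous (f z))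
    (h : ∀ K, IsCompact K → ∀ q : ℝ, MeasurableSet {z | ∃ x ∈ S z, x ∈ K ∧ f z x ≤ q})
    {K : Set E} (hK : IsCompact K) : MeasurableSet {z | ∃ x ∈ argminOn (f z) (S z), x ∈ K} := by
  -- A minimizer lies in `K` iff, for every `k`, some rational level `q` is reached on `S z ∩ K`
  -- while `q - 1 / (k + 1)` is reached nowhere on `S z`. The compact covering reduces the latter to
  -- countably many hit conditions, and compactness of `S z ∩ K` turns approximate minimizers into
  -- one minimizer.
  have hset : {z | ∃ x ∈ argminOn (f z) (S z), x ∈ K} =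
      ⋂ k : ℕ, ⋃ q : ℚ, {z | ∃ x ∈ S z, x ∈ K ∧ f z x ≤ q} ∩
        ⋂ N, {z | ∃ x ∈ S z, x ∈ compactCovering E N ∧ f z x ≤ q - 1 / ((k : ℝ) + 1)}ᶜ := by
    ext z
    simp only [Set.mem_iInter, Set.mem_iUnion, Set.mem_inter_iff, Set.mem_compl_iff, Set.mem_ofPred_eq]
    constructor
    · rintro ⟨x, ⟨hxS, hx⟩, hxK⟩ k
      obtain ⟨q, hq, hq'⟩ := exists_rat_btwn
        (lt_add_of_pos_right (f z x) (Nat.one_div_pos_of_nat (α := ℝ) (n := k)))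
      refine ⟨q, ⟨x, hxS, hxK, hq.le⟩, ?_⟩
      rintro N ⟨y, hy, -, hyq⟩
      linarith [hx y hy]
    · intro hz
      have hlow : ∀ k : ℕ, ∃ x ∈ S z, x ∈ K ∧ ∀ y ∈ S z, f z x - 1 / ((k : ℝ) + 1) ≤ f z y := by
        intro k
        obtain ⟨q, ⟨x, hxS, hxK, hxq⟩, hq⟩ := hz k
        refine ⟨x, hxS, hxK, fun y hy => ?_⟩
        obtain ⟨N, hN⟩ := exists_mem_compactCovering y
        have h1 := fun hle => hq N ⟨y, hy, hN, hle⟩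
        linarith [not_le.1 h1]
      obtain ⟨x₀, hx₀S, hx₀K, -⟩ := hlow 0
      obtain ⟨x, hx, hmin⟩ := (hK.inter_left (hS z)).exists_isMinOn ⟨x₀, hx₀S, hx₀K⟩
        (hf z).continuousOn
      refine ⟨x, ⟨hx.1, fun y hy => ?_⟩, hx.2⟩
      have hle : ∀ k : ℕ, f z x - f z y ≤ 1 / ((k : ℝ) + 1) := fun k => by
        obtain ⟨x', hx'S, hx'K, hx'⟩ := hlow k
        have h1 : f z x ≤ f z x' := hmin (a := x') ⟨hx'S, hx'K⟩
        linarith [hx' y hy]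
      exact sub_nonpos.1 (ge_of_tendsto' tendsto_one_div_add_atTop_nhds_zero_nat hle)
  rw [hset]
  exact MeasurableSet.iInter fun k => MeasurableSet.iUnion fun q => (h K hK q).inter
    (MeasurableSet.iInter fun N => (h _ (isCompact_compactCovering E N) _).compl)

/-- For a fixed function, a sublevel set cut with `K` is again compact. Hypothesis and conclusion
thus have the same form, and minimizations can be iterated. -/
theorem measurableSet_argminOn_hits_const {Z E : Type*} [MeasurableSpace Z] [TopologicalSpace E]
    [SigmaCompactSpace E] {S : Z → Set E} (hS : ∀ z, IsClosed (S z)) {f : E → ℝ}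
    (hf : Continuous f) (h : ∀ K, IsCompact K → MeasurableSet {z | ∃ x ∈ S z, x ∈ K})
    {K : Set E} (hK : IsCompact K) : MeasurableSet {z | ∃ x ∈ argminOn f (S z), x ∈ K} :=
  measurableSet_argminOn_hits hS (fun _ => hf)
    (fun _ hK _ => h _ (hK.inter_right (isClosed_le hf continuous_const))) hK

/-- A closed set over `Z` hits compact sets in a closed set of parameters. -/
theorem isClosed_hits {Z E : Type*} [TopologicalSpace Z] [TopologicalSpace E] {C : Set (Z × E)}
    (hC : IsClosed C) {K : Set E} (hK : IsCompact K) :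
    IsClosed {z | ∃ x, (z, x) ∈ C ∧ x ∈ K} := by
  have : CompactSpace K := isCompact_iff_compactSpace.1 hK
  have h1 : IsClosed {p : Z × K | (p.1, (p.2 : E)) ∈ C} := hC.preimage (by fun_prop)
  convert! isClosedMap_fst_of_compactSpace _ h1 using 1
  ext z
  simp [and_comm]

/-- The hits of open sets are measurable if those of compact sets are. -/
theorem measurableSet_hits_isOpen {Z E : Type*} [MeasurableSpace Z] [PseudoEMetricSpace E]
    [SigmaCompactSpace E] {S : Z → Set E}
    (h : ∀ K, IsCompact K → MeasurableSet {z | ∃ x ∈ S z, x ∈ K}) {U : Set E} (hU : IsOpen U) :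
    MeasurableSet {z | ∃ x ∈ S z, x ∈ U} := by
  obtain ⟨F, hF, -, hFU, -⟩ := hU.exists_iUnion_isClosed
  have hset : {z | ∃ x ∈ S z, x ∈ U} =
      ⋃ k, ⋃ N, {z | ∃ x ∈ S z, x ∈ compactCovering E N ∩ F k} := by
    ext z
    simp only [Set.mem_iUnion, Set.mem_ofPred_eq]
    constructor
    · rintro ⟨x, hx, hxU⟩
      rw [← hFU] at hxU
      obtain ⟨k, hk⟩ := Set.mem_iUnion.1 hxU
      obtain ⟨N, hN⟩ := exists_mem_compactCovering x
      exact ⟨k, N, x, hx, hN, hk⟩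
    · rintro ⟨k, N, x, hx, -, hk⟩
      exact ⟨x, hx, hFU ▸ Set.mem_iUnion_of_mem k hk⟩
  rw [hset]
  exact MeasurableSet.iUnion fun k => MeasurableSet.iUnion fun N =>
    h _ ((isCompact_compactCovering E N).inter_right (hF k))

end

noncomputable section

namespace MILCQP

/-! ### Measurability of the comparison of colors -/

/-- The values of the functions `F i` are compared measurably. -/
def MeasurableComparison {Ω ι α : Type*} [MeasurableSpace Ω] [LT α] (F : ι → Ω → α) : Prop :=
  ∀ i j, MeasurableSet {z | F i z < F j z}

namespace MeasurableComparison

variable {Ω ι κ α β : Type*} [MeasurableSpace Ω]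

theorem comp [LT α] {F : ι → Ω → α} (hF : MeasurableComparison F) (e : κ → ι) :
    MeasurableComparison fun i => F (e i) := fun i j => hF (e i) (e j)

theorem measurableSet_eq [LinearOrder α] {F : ι → Ω → α} (hF : MeasurableComparison F) (i j : ι) :
    MeasurableSet {z | F i z = F j z} := by
  have h : {z | F i z = F j z} = ({z | F i z < F j z} ∪ {z | F j z < F i z})ᶜ := by
    ext z
    simp [le_antisymm_iff, and_comm]
  rw [h]
  exact ((hF i j).union (hF j i)).compl

theorem of_measurable {F : ι → Ω → ℝ} (hF : ∀ i, Measurable (F i)) : MeasurableComparison F :=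
  fun i j => measurableSet_lt (hF i) (hF j)

theorem of_discrete [LT α] [TopologicalSpace α] [DiscreteTopology α] [TopologicalSpace Ω]
    [OpensMeasurableSpace Ω] {F : ι → Ω → α} (hF : ∀ i, Continuous (F i)) :
    MeasurableComparison F := fun i j =>
  ((isOpen_discrete {p : α × α | p.1 < p.2}).preimage ((hF i).prodMk (hF j))).measurableSet

theorem prodLex [LinearOrder α] [LinearOrder β] {F : ι → Ω → α} {F' : ι → Ω → β}
    (hF : MeasurableComparison F) (hF' : MeasurableComparison F') :
    MeasurableComparison fun i z => (toLex (F i z, F' i z) : α ×ₗ β) := by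
  intro i j
  simp only [Prod.Lex.toLex_lt_toLex]
  exact (hF i j).union ((hF.measurableSet_eq i j).inter (hF' i j))

theorem of_iff [LT α] [LT β] {F : ι → Ω → α} {F' : ι → Ω → β} (hF : MeasurableComparison F)
    (h : ∀ i j z, F' i z < F' j z ↔ F i z < F j z) : MeasurableComparison F' := fun i j => by
  simp only [h]
  exact hF i j

end MeasurableComparison

/-- The deciding color has positive multiplicity in the larger multiset, and colors outside the
range of `e` have multiplicity zero in both. Quantification over all colors thus reduces to the
index type. -/
theorem mset_lt_iff {ι κ γ α : Type} [LinearOrder α] {s : Finset κ} {t : Finset γ} {f : κ → α}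
    {g : γ → α} (e : ι → α) (hf : ∀ a, ∃ v, e v = f a) (hg : ∀ a, ∃ v, e v = g a) :
    mset s f < mset t g ↔ ∃ u, (∀ v, e v < e u →
      (s.filter fun a => f a = e v).card = (t.filter fun a => g a = e v).card) ∧
      (s.filter fun a => f a = e u).card < (t.filter fun a => g a = e u).card := by
  rw [Finsupp.Lex.lt_iff]
  simp only [mset_apply]
  constructor
  · rintro ⟨c, hlow, hc⟩
    obtain ⟨a, ha⟩ := Finset.card_pos.1 (Nat.zero_lt_of_lt hc)
    obtain ⟨v, hv⟩ := hg a
    rw [(Finset.mem_filter.1 ha).2] at hv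
    subst hv
    exact ⟨v, fun w hw => hlow _ hw, hc⟩
  · rintro ⟨u, hlow, hu⟩
    refine ⟨e u, fun d hd => ?_, hu⟩
    by_cases h : ∃ v, e v = d
    · obtain ⟨v, rfl⟩ := h
      exact hlow v hd
    · have hs : (s.filter fun a => f a = d) = ∅ :=
        Finset.filter_eq_empty_iff.2 fun a _ ha => h (ha ▸ hf a)
      have ht : (t.filter fun a => g a = d) = ∅ :=
        Finset.filter_eq_empty_iff.2 fun a _ ha => h (ha ▸ hg a)
      rw [hs, ht]
      rfl

/-- No sigma-algebra on the colors is needed: multiplicities are counted by equality of finitely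
many color functions, and the deciding color is sought among finitely many indices. -/
theorem MeasurableComparison.mset {Ω ι κ α : Type} [MeasurableSpace Ω] [LinearOrder α] [Finite ι]
    [Finite κ] {s : ι → Ω → Finset κ} (hs : ∀ i a, MeasurableSet {z | a ∈ s i z})
    {F : ι × κ → Ω → α} (hF : MeasurableComparison F) :
    MeasurableComparison fun i z => MILCQP.mset (s i z) fun a => F (i, a) z := by
  classical
  have := Fintype.ofFinite κ
  have hcount : ∀ i v, Measurable fun z => ((s i z).filter fun a => F (i, a) z = F v z).card := by
    intro i v
    have h : ∀ z, ((s i z).filter fun a => F (i, a) z = F v z).card =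
        ∑ a, if a ∈ s i z ∧ F (i, a) z = F v z then 1 else 0 := by
      intro z
      rw [← Finset.card_filter]
      congr 1
      ext a
      simp
    simp only [h]
    exact Finset.measurable_sum _ fun a _ => Measurable.ite
      ((hs i a).inter (hF.measurableSet_eq _ _)) measurable_const measurable_const
  intro i j
  have h : ∀ z, MILCQP.mset (s i z) (fun a => F (i, a) z) < MILCQP.mset (s j z)
      (fun a => F (j, a) z) ↔ ∃ u, (∀ v, F v z < F u z →
      ((s i z).filter fun a => F (i, a) z = F v z).card =
        ((s j z).filter fun a => F (j, a) z = F v z).card) ∧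
      ((s i z).filter fun a => F (i, a) z = F u z).card <
        ((s j z).filter fun a => F (j, a) z = F u z).card := fun z =>
    mset_lt_iff (fun v => F v z) (fun a => ⟨(i, a), rfl⟩) fun a => ⟨(j, a), rfl⟩
  simp only [h, Set.ofPred_exists, Set.ofPred_and, Set.ofPred_forall]
  refine MeasurableSet.iUnion fun u => (MeasurableSet.iInter fun v => ?_).inter
    (measurableSet_lt (hcount i u) (hcount j u))
  have h2 : {z | F v z < F u z → ((s i z).filter fun a => F (i, a) z = F v z).card =
      ((s j z).filter fun a => F (j, a) z = F v z).card} = {z | F v z < F u z}ᶜ ∪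
      {z | ((s i z).filter fun a => F (i, a) z = F v z).card =
        ((s j z).filter fun a => F (j, a) z = F v z).card} := by
    ext z
    simp only [Set.mem_ofPred_eq, Set.mem_union, Set.mem_compl_iff, imp_iff_not_or]
  simp only [h2]
  exact (hF v u).compl.union (measurableSet_eq_fun (hcount i v) (hcount j v))

theorem toLex_lowerBound_lt_iff (a b : LowerBound) :
    toLex a < toLex b ↔ (toLex (lowerCode a) : ℝ ×ₗ ℝ) < toLex (lowerCode b) := by
  rw [Prod.Lex.toLex_lt_toLex]
  rcases a with ⟨⟩ | a <;> rcases b with ⟨⟩ | b <;> simp [lowerCode]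

/-- The flag is negated because `upperCode` gives finite bounds the larger flag, whereas `+∞` has to
come last. -/
theorem toLex_upperBound_lt_iff (a b : UpperBound) :
    toLex a < toLex b ↔ (toLex (-(upperCode a).1, (upperCode a).2) : ℝ ×ₗ ℝ) <
      toLex (-(upperCode b).1, (upperCode b).2) := by
  rw [Prod.Lex.toLex_lt_toLex]
  rcases a with a | ⟨⟩ <;> rcases b with b | ⟨⟩ <;> simp [upperCode]

variable {m n : ℕ}

namespace Graph

theorem measurableComparison_wlColors (k : ℕ) :
    MeasurableComparison (fun (i : Fin m) (G : Graph m n) => (G.wlColors k).1 i) ∧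
      MeasurableComparison (fun (j : Fin n) (G : Graph m n) => (G.wlColors k).2 j) := by
  induction k with
  | zero =>
    have hl : MeasurableComparison fun (j : Fin n) (G : Graph m n) => toLex (G.l j) :=
      (MeasurableComparison.prodLex
        (.of_measurable fun j => (continuous_lowerCode.comp (continuous_l j)).fst.measurable)
        (.of_measurable fun j => (continuous_lowerCode.comp (continuous_l j)).snd.measurable)).of_iff
        fun _ _ _ => toLex_lowerBound_lt_iff _ _
    have hu : MeasurableComparison fun (j : Fin n) (G : Graph m n) => toLex (G.u j) :=
      (MeasurableComparison.prodLex
        (.of_measurable fun j => (continuous_upperCode.comp (continuous_u j)).fst.neg.measurable)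
        (.of_measurable fun j => (continuous_upperCode.comp (continuous_u j)).snd.measurable)).of_iff
        fun _ _ _ => toLex_upperBound_lt_iff _ _
    exact ⟨.prodLex (.of_measurable fun i => (continuous_b i).measurable)
        (.of_discrete continuous_rel),
      .prodLex (.of_measurable fun j => (continuous_c j).measurable)
        (hl.prodLex (hu.prodLex (.of_discrete continuous_isInt)))⟩
  | succ k ih =>
    have hA : ∀ (i : Fin m) (j : Fin n), MeasurableSet {G : Graph m n | G.A i j ≠ 0} := fun i j =>
      (measurableSet_eq_fun (continuous_A i j).measurable measurable_const).compl
    have hQ : ∀ j j' : Fin n, MeasurableSet {G : Graph m n | G.Q j j' ≠ 0} := fun j j' =>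
      (measurableSet_eq_fun (continuous_Q j j').measurable measurable_const).compl
    have h1 : MeasurableComparison fun (p : Fin m × Fin n) (G : Graph m n) =>
        (toLex ((G.wlColors k).2 p.2, G.A p.1 p.2) : (colorSpace k).W ×ₗ ℝ) :=
      (ih.2.comp Prod.snd).prodLex (.of_measurable fun p => (continuous_A p.1 p.2).measurable)
    have h2 : MeasurableComparison fun (p : Fin n × Fin m) (G : Graph m n) =>
        (toLex ((G.wlColors k).1 p.2, G.A p.2 p.1) : (colorSpace k).V ×ₗ ℝ) :=
      (ih.1.comp Prod.snd).prodLex (.of_measurable fun p => (continuous_A p.2 p.1).measurable)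
    have h3 : MeasurableComparison fun (p : Fin n × Fin n) (G : Graph m n) =>
        (toLex ((G.wlColors k).2 p.2, G.Q p.1 p.2) : (colorSpace k).W ×ₗ ℝ) :=
      (ih.2.comp Prod.snd).prodLex (.of_measurable fun p => (continuous_Q p.1 p.2).measurable)
    have h1' := h1.mset (s := fun i G => G.nbrVW i) fun i j => by
      simpa only [mem_nbrVW] using hA i j
    have h2' := h2.mset (s := fun j G => G.nbrWV j) fun j i => by
      simpa only [mem_nbrWV] using hA i j
    have h3' := h3.mset (s := fun j G => G.nbrWW j) fun j j' => by
      simpa only [mem_nbrWW] using hQ j j'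
    exact ⟨ih.1.prodLex h1', ih.2.prodLex (h2'.prodLex h3')⟩

theorem measurableSet_varLT (j j' : Fin n) : MeasurableSet {G : Graph m n | G.VarLT j j'} := by
  simp only [VarLT, Set.ofPred_exists]
  exact MeasurableSet.iUnion fun k => (measurableComparison_wlColors k).2 j j'

end Graph

theorem measurableSet_separatedAt (m n K : ℕ) : MeasurableSet (separatedAt m n K) := by
  have h : separatedAt m n K =
      ⋂ (j : Fin n) (j' : Fin n) (_ : j ≠ j'), {G | G.colorW K j = G.colorW K j'}ᶜ := by
    ext G
    simp only [separatedAt, Set.mem_iInter, Set.mem_ofPred_eq, Set.mem_compl_iff]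
    exact forall_congr' fun j => forall_congr' fun j' => not_imp_not.symm
  rw [h]
  exact MeasurableSet.iInter fun j => MeasurableSet.iInter fun j' => MeasurableSet.iInter fun _ =>
    ((Graph.measurableComparison_wlColors K).2.measurableSet_eq j j').compl

theorem monotone_separatedAt (m n : ℕ) : Monotone (separatedAt m n) := by
  intro K K' hK G hG j j' h
  refine hG j j' ?_
  by_contra hne
  rcases lt_or_gt_of_ne hne with hlt | hlt
  · exact (G.colorW_lt_mono hK _ _ hlt).ne h
  · exact (G.colorW_lt_mono hK _ _ hlt).ne' h

theorem unfoldable_subset_iUnion_separatedAt (m n : ℕ) :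
    unfoldable m n ⊆ ⋃ K, separatedAt m n K := by
  intro G hG
  obtain ⟨K, hK⟩ := G.exists_stable
  exact Set.mem_iUnion.2 ⟨K, fun j j' h => hG j j' ((hK K le_rfl j j').1 h)⟩

end MILCQP

end

noncomputable section

namespace MILCQP

variable {m n : ℕ}

/-! ### Measurability of the optimal solution map -/

namespace Graph

theorem isClosed_setOf_holds : IsClosed {p : Rel × ℝ × ℝ | p.1.Holds p.2.1 p.2.2} := by
  have h : {p : Rel × ℝ × ℝ | p.1.Holds p.2.1 p.2.2} =
      ⋂ r : Rel, {p | p.1 = r}ᶜ ∪ {p | r.Holds p.2.1 p.2.2} := by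
    ext p
    simp only [Set.mem_iInter, Set.mem_union, Set.mem_compl_iff, Set.mem_ofPred_eq,
      ← imp_iff_not_or]
    exact ⟨fun h r hr => hr ▸ h, fun h => h _ rfl⟩
  rw [h]
  refine isClosed_iInter fun r => IsClosed.union ?_ ?_
  · exact ((isOpen_discrete {r}).preimage continuous_fst).isClosed_compl
  · cases r
    · exact isClosed_le (by fun_prop) (by fun_prop)
    · exact isClosed_eq (by fun_prop) (by fun_prop)
    · exact isClosed_le (by fun_prop) (by fun_prop)

theorem isClosed_setOf_lowerBoundHolds :
    IsClosed {p : LowerBound × ℝ | LowerBoundHolds p.1 p.2} := by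
  have h : {p : LowerBound × ℝ | LowerBoundHolds p.1 p.2} =
      -- The flag factor is 0 for an infinite bound, making the inequality void, and 1 for a finite
      -- one.
      {p | (lowerCode p.1).1 * ((lowerCode p.1).2 - p.2) ≤ 0} := by
    ext ⟨⟨⟩ | a, t⟩ <;> simp [LowerBoundHolds, lowerCode]
  have hc : Continuous fun p : LowerBound × ℝ => lowerCode p.1 :=
    continuous_lowerCode.comp continuous_fst
  rw [h]
  exact isClosed_le (hc.fst.mul (hc.snd.sub continuous_snd)) continuous_const

theorem isClosed_setOf_upperBoundHolds :
    IsClosed {p : UpperBound × ℝ | UpperBoundHolds p.1 p.2} := by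
  have h : {p : UpperBound × ℝ | UpperBoundHolds p.1 p.2} =
      {p | (upperCode p.1).1 * (p.2 - (upperCode p.1).2) ≤ 0} := by
    ext ⟨a | ⟨⟩, t⟩ <;> simp [UpperBoundHolds, upperCode]
  have hc : Continuous fun p : UpperBound × ℝ => upperCode p.1 :=
    continuous_upperCode.comp continuous_fst
  rw [h]
  exact isClosed_le (hc.fst.mul (continuous_snd.sub hc.snd)) continuous_const

theorem isClosed_setOf_isInt :
    IsClosed {p : Bool × ℝ | p.1 = true → ∃ z : ℤ, p.2 = z} := by
  have h : {p : Bool × ℝ | p.1 = true → ∃ z : ℤ, p.2 = z} =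
      {p | p.1 = true}ᶜ ∪ {p | p.2 ∈ Set.range ((↑) : ℤ → ℝ)} := by
    ext p
    simp only [Set.mem_union, Set.mem_compl_iff, Set.mem_ofPred_eq, Set.mem_range,
      ← imp_iff_not_or, eq_comm (b := p.2)]
  rw [h]
  exact ((isOpen_discrete {true}).preimage continuous_fst).isClosed_compl.union
    (Int.isClosedEmbedding_coe_real.isClosed_range.preimage continuous_snd)

theorem isClosed_setOf_feasible :
    IsClosed {p : Graph m n × EuclideanSpace ℝ (Fin n) | p.1.Feasible p.2} := by
  have hx : ∀ j, Continuous fun p : Graph m n × EuclideanSpace ℝ (Fin n) => p.2 j := fun j => by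
    fun_prop
  have hA : ∀ i, Continuous fun p : Graph m n × EuclideanSpace ℝ (Fin n) =>
      ∑ j, p.1.A i j * p.2 j := fun i => continuous_finsetSum _ fun j _ =>
    ((continuous_A i j).comp continuous_fst).mul (hx j)
  simp only [Feasible, Set.ofPred_and, Set.ofPred_forall]
  refine (isClosed_iInter fun i => ?_).inter ((isClosed_iInter fun j => ?_).inter
    ((isClosed_iInter fun j => ?_).inter (isClosed_iInter fun j => ?_)))
  · exact isClosed_setOf_holds.preimage (((continuous_rel i).comp continuous_fst).prodMk
      ((hA i).prodMk ((continuous_b i).comp continuous_fst)))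
  · exact isClosed_setOf_lowerBoundHolds.preimage
      (((continuous_l j).comp continuous_fst).prodMk (hx j))
  · exact isClosed_setOf_upperBoundHolds.preimage
      (((continuous_u j).comp continuous_fst).prodMk (hx j))
  · exact isClosed_setOf_isInt.preimage
      (((continuous_isInt j).comp continuous_fst).prodMk (hx j))

theorem continuous_objective_uncurry :
    Continuous fun p : Graph m n × EuclideanSpace ℝ (Fin n) => p.1.objective p.2 := by
  have hx : ∀ j, Continuous fun p : Graph m n × EuclideanSpace ℝ (Fin n) => p.2 j := fun j => by
    fun_prop
  refine (continuous_const.mul (continuous_finsetSum _ fun j _ => continuous_finsetSum _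
    fun j' _ => ((hx j).mul ((continuous_Q j j').comp continuous_fst)).mul (hx j'))).add
    (continuous_finsetSum _ fun j _ => ((continuous_c j).comp continuous_fst).mul (hx j))

/-- Feasibility and objective are closed and continuous jointly in graph and point, so the graphs
whose feasible sublevel set meets a compact set form a closed set; minimization then keeps hits
measurable. -/
theorem measurableSet_isOptimal_hits {K : Set (EuclideanSpace ℝ (Fin n))} (hK : IsCompact K) :
    MeasurableSet {G : Graph m n | ∃ x ∈ {x | G.IsOptimal x}, x ∈ K} := by
  refine measurableSet_argminOn_hits (S := fun G : Graph m n => {x | G.Feasible x})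
    (f := fun G => G.objective) (fun G => G.isClosed_feasible) (fun G => G.continuous_objective)
    (fun K hK q => ?_) hK
  have hC : IsClosed {p : Graph m n × EuclideanSpace ℝ (Fin n) |
      p.1.Feasible p.2 ∧ p.1.objective p.2 ≤ q} :=
    isClosed_setOf_feasible.inter (isClosed_le continuous_objective_uncurry continuous_const)
  convert! (isClosed_hits hC hK).measurableSet using 1
  ext G
  simp only [Set.mem_ofPred_eq]
  exact exists_congr fun x => by tauto

end Graph

theorem measurableSet_solvable (m n : ℕ) : MeasurableSet (solvable m n) := by
  have h := measurableSet_hits_isOpen (fun K hK =>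
    Graph.measurableSet_isOptimal_hits (m := m) (n := n) hK) isOpen_univ
  simpa [solvable] using h

/-- The elements of `S` of minimal norm whose coordinates `τ 0, …, τ (k - 1)` are successively
minimal. -/
def lexArgmin (τ : Equiv.Perm (Fin n)) (S : Set (EuclideanSpace ℝ (Fin n))) :
    ℕ → Set (EuclideanSpace ℝ (Fin n))
  | 0 => argminOn norm S
  | k + 1 => if h : k < n then argminOn (fun x => x (τ ⟨k, h⟩)) (lexArgmin τ S k)
      else lexArgmin τ S k

theorem isClosed_lexArgmin (τ : Equiv.Perm (Fin n)) {S : Set (EuclideanSpace ℝ (Fin n))}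
    (hS : IsClosed S) (k : ℕ) : IsClosed (lexArgmin τ S k) := by
  induction k with
  | zero => exact isClosed_argminOn continuous_norm hS
  | succ k ih =>
    rw [lexArgmin]
    split_ifs with h
    · exact isClosed_argminOn (by fun_prop) ih
    · exact ih

theorem measurableSet_lexArgmin_hits (τ : Equiv.Perm (Fin n)) (k : ℕ) :
    ∀ K, IsCompact K →
      MeasurableSet {G : Graph m n | ∃ x ∈ lexArgmin τ {x | G.IsOptimal x} k, x ∈ K} := by
  induction k with
  | zero =>
    exact fun K hK => measurableSet_argminOn_hits_const (fun G => G.isClosed_optimal)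
      continuous_norm (fun K hK => Graph.measurableSet_isOptimal_hits hK) hK
  | succ k ih =>
    intro K hK
    simp only [lexArgmin]
    split_ifs with h
    · exact measurableSet_argminOn_hits_const
        (fun G => isClosed_lexArgmin τ G.isClosed_optimal k) (by fun_prop) ih hK
    · exact ih K hK

/-- The optimal solution map is obtained by successive minimization, once the variable nodes are
sorted by `τ`. -/
theorem lexArgmin_eq_singleton {G : Graph m n} {τ : Equiv.Perm (Fin n)}
    (hτ : ∀ i i', i < i' → G.VarLT (τ i) (τ i')) {x : EuclideanSpace ℝ (Fin n)}
    (hx : G.IsLeastOptimal x) : lexArgmin τ {x | G.IsOptimal x} n = {x} := by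
  have key : ∀ k, x ∈ lexArgmin τ {x | G.IsOptimal x} k ∧
      ∀ y ∈ lexArgmin τ {x | G.IsOptimal x} k, G.IsOptimal y ∧ ‖y‖ = ‖x‖ ∧
        ∀ i : Fin n, (i : ℕ) < k → y (τ i) = x (τ i) := by
    intro k
    induction k with
    | zero =>
      have hmin : ∀ y, G.IsOptimal y → ‖x‖ ≤ ‖y‖ := by
        intro y hy
        by_cases hyx : y = x
        · rw [hyx]
        · rcases hx.2 y hy hyx with h | h
          · exact h.le
          · exact h.1.le
      exact ⟨⟨hx.1, hmin⟩, fun y hy => ⟨hy.1, le_antisymm (hy.2 x hx.1) (hmin y hy.1),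
        fun i hi => absurd hi (Nat.not_lt_zero _)⟩⟩
    | succ k ih =>
      obtain ⟨hxk, hyk⟩ := ih
      simp only [lexArgmin]
      split_ifs with hk
      · have hmin : ∀ y ∈ lexArgmin τ {x | G.IsOptimal x} k, x (τ ⟨k, hk⟩) ≤ y (τ ⟨k, hk⟩) := by
          intro y hy
          obtain ⟨hyo, hyn, hyi⟩ := hyk y hy
          by_cases hyx : y = x
          · rw [hyx]
          · rcases hx.2 y hyo hyx with h | ⟨-, j, hj, hlt⟩
            · exact absurd hyn h.ne'
            · obtain ⟨l, rfl⟩ := τ.surjective j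
              -- Let `τ l` be the node deciding the comparison of `x` with `y`. It cannot precede
              -- position `k`, where the two agree; at `k` the inequality is strict, and if it comes
              -- later they agree at `k`.
              rcases lt_trichotomy l ⟨k, hk⟩ with h | rfl | h
              · exact absurd (hyi l h) hlt.ne'
              · exact hlt.le
              · exact (hj _ (hτ _ _ h)).le
        refine ⟨⟨hxk, hmin⟩, fun y hy => ?_⟩
        obtain ⟨hyo, hyn, hyi⟩ := hyk y hy.1
        refine ⟨hyo, hyn, fun i hi => ?_⟩
        rcases (Nat.lt_succ_iff.1 hi).eq_or_lt with h | h
        · obtain rfl : i = ⟨k, hk⟩ := Fin.ext h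
          exact le_antisymm (hy.2 x hxk) (hmin y hy.1)
        · exact hyi i h
      · exact ⟨hxk, fun y hy => ⟨(hyk y hy).1, (hyk y hy).2.1, fun i _ =>
          (hyk y hy).2.2 i (i.2.trans_le (not_lt.1 hk))⟩⟩
  refine Set.eq_singleton_iff_unique_mem.2 ⟨(key n).1, fun y hy => PiLp.ext fun j => ?_⟩
  obtain ⟨i, rfl⟩ := τ.surjective j
  exact ((key n).2 y hy).2.2 i i.2

theorem exists_perm_varLT {G : Graph m n} {K : ℕ} (hG : G ∈ separatedAt m n K) :
    ∃ τ : Equiv.Perm (Fin n), ∀ i i', i < i' → G.VarLT (τ i) (τ i') := by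
  refine ⟨Tuple.sort (G.colorW K), fun i i' hi => ⟨K, ?_⟩⟩
  refine lt_of_le_of_ne (Tuple.monotone_sort (G.colorW K) hi.le) fun h => hi.ne ?_
  exact (Tuple.sort (G.colorW K)).injective (hG _ _ h)

/-- The order of the nodes varies with the graph but takes finitely many values `τ`. On each
resulting measurable piece, `lexArgmin` is the singleton of the solution, so the preimage of `U`
becomes a hit condition. -/
theorem measurableSet_solMap_preimage (K : ℕ) {U : Set (EuclideanSpace ℝ (Fin n))}
    (hU : IsOpen U) : MeasurableSet ((solvable m n ∩ separatedAt m n K) ∩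
      (fun G : Graph m n => G.solMap) ⁻¹' U) := by
  have hset : (solvable m n ∩ separatedAt m n K) ∩ (fun G : Graph m n => G.solMap) ⁻¹' U =
      ⋃ τ : Equiv.Perm (Fin n), (solvable m n ∩ separatedAt m n K) ∩
        ((⋂ (i) (i') (_ : i < i'), {G | G.VarLT (τ i) (τ i')}) ∩
          {G | ∃ x ∈ lexArgmin τ {x | G.IsOptimal x} n, x ∈ U}) := by
    ext G
    simp only [Set.mem_iUnion, Set.mem_inter_iff, Set.mem_preimage, Set.mem_iInter,
      Set.mem_ofPred_eq]
    have hleast : G ∈ solvable m n → G ∈ separatedAt m n K → G.IsLeastOptimal G.solMap :=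
      fun h h' => G.solMap_isLeastOptimal (separatedAt_subset_unfoldable m n K h') h
    constructor
    · rintro ⟨⟨hs, hu⟩, hGU⟩
      obtain ⟨τ, hτ⟩ := exists_perm_varLT hu
      refine ⟨τ, ⟨hs, hu⟩, hτ, G.solMap, ?_, hGU⟩
      rw [lexArgmin_eq_singleton hτ (hleast hs hu)]
      rfl
    · rintro ⟨τ, ⟨hs, hu⟩, hτ, x, hx, hxU⟩
      rw [lexArgmin_eq_singleton hτ (hleast hs hu), Set.mem_singleton_iff] at hx
      exact ⟨⟨hs, hu⟩, hx ▸ hxU⟩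
  rw [hset]
  refine MeasurableSet.iUnion fun τ => ((measurableSet_solvable m n).inter
    (measurableSet_separatedAt m n K)).inter (MeasurableSet.inter ?_ ?_)
  · exact MeasurableSet.iInter fun i => MeasurableSet.iInter fun i' => MeasurableSet.iInter fun _ =>
      Graph.measurableSet_varLT _ _
  · exact measurableSet_hits_isOpen (measurableSet_lexArgmin_hits τ n) hU

open MeasureTheory in
/-- Up to small measure, almost surely unfoldable graphs are separated at a fixed iteration. -/
theorem exists_measure_compl_lt {P : Measure (Graph m n)} [IsProbabilityMeasure P]
    (hP : ∀ᵐ G ∂P, G ∈ solvable m n ∩ unfoldable m n) {ε : ENNReal} (hε : ε ≠ 0) :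
    ∃ K, P (solvable m n ∩ separatedAt m n K)ᶜ < ε := by
  have hanti : Antitone fun K => (solvable m n ∩ separatedAt m n K)ᶜ := fun K K' h =>
    Set.compl_subset_compl.2 (Set.inter_subset_inter_right _ (monotone_separatedAt m n h))
  have hlim := tendsto_measure_iInter_atTop (μ := P) (fun K => ((measurableSet_solvable m n).inter
    (measurableSet_separatedAt m n K)).compl.nullMeasurableSet) hanti ⟨0, measure_ne_top P _⟩
  -- Every unfoldable graph is separated at some finite round, so the decreasing complements shrink
  -- to a null set.
  have hzero : P (⋂ K, (solvable m n ∩ separatedAt m n K)ᶜ) = 0 := by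
    refine measure_mono_null (fun G hG => ?_) (ae_iff.1 hP)
    intro hG'
    obtain ⟨K, hK⟩ := Set.mem_iUnion.1 (unfoldable_subset_iUnion_separatedAt m n hG'.2)
    exact Set.mem_iInter.1 hG K ⟨hG'.1, hK⟩
  rw [hzero] at hlim
  exact (hlim.eventually_lt_const (pos_iff_ne_zero.2 hε)).exists

end MILCQP

end

/-! ### The approximation theorem -/

theorem theorem4p6 (m n : ℕ) (P : MeasureTheory.Measure (MILCQP.Graph m n))
    [MeasureTheory.IsProbabilityMeasure P]
    (hP : ∀ᵐ G ∂P, G ∈ MILCQP.solvable m n ∩ MILCQP.unfoldable m n)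
    (ε δ : ℝ) (hε : 0 < ε) (hδ : 0 < δ) :
    ∃ F : MILCQP.GNN,
      P {G | δ < ‖F.output G - G.solMap‖} < ENNReal.ofReal ε := by
  have hε2 : ENNReal.ofReal ε / 2 ≠ 0 := (ENNReal.half_pos (ENNReal.ofReal_pos.2 hε).ne').ne'
  obtain ⟨K, hK⟩ := MILCQP.exists_measure_compl_lt hP hε2
  obtain ⟨X, hsub, hX, hcont, hlt⟩ := exists_isCompact_continuousOn P
    (fun U hU => MILCQP.measurableSet_solMap_preimage K hU) hε2
  obtain ⟨F, hF⟩ := MILCQP.exists_output_eq_solMap hX hsub hcont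
  refine ⟨F, ?_⟩
  -- The error is zero on `X`, so a deviation can only occur where round `K` fails to separate a
  -- solvable graph, where no solution exists, or in the part removed by Lusin's theorem.
  have hcover : {G | δ < ‖F.output G - G.solMap‖} ⊆
      (MILCQP.solvable m n ∩ MILCQP.separatedAt m n K)ᶜ ∪
        ((MILCQP.solvable m n ∩ MILCQP.separatedAt m n K) \ X) := by
    intro G hG
    by_cases hGX : G ∈ X
    · have h : δ < ‖F.output G - G.solMap‖ := hG
      rw [hF G hGX, sub_self, norm_zero] at h
      exact absurd h hδ.not_gt
    · by_cases hGD : G ∈ MILCQP.solvable m n ∩ MILCQP.separatedAt m n K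
      · exact Or.inr ⟨hGD, hGX⟩
      · exact Or.inl hGD
  calc P {G | δ < ‖F.output G - G.solMap‖}
      ≤ _ := MeasureTheory.measure_mono hcover
    _ ≤ _ := MeasureTheory.measure_union_le _ _
    _ < ENNReal.ofReal ε / 2 + ENNReal.ofReal ε / 2 := ENNReal.add_lt_add hK hlt
    _ = ENNReal.ofReal ε := ENNReal.add_halves _
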